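/- Let $n\ge 1$ and let $\mathcal K^n$ be the class of convex bodies (nonempty compact convex sets) in $\mathbb R^n$, with Minkowski addition and the Hausdorff distance. For $K\in\mathcal K^n$ let $h(K)(\nu)=\sup_{x\in K}x\cdot\nu$ be its support function and $$M(K)=\frac{2}{\mathcal H^{n-1}(\mathbb S^{n-1})}\int_{\mathbb S^{n-1}}h(K)\,d\mathcal H^{n-1}$$ its mean width. Let $\alpha\in\mathbb R\setminus\{0\}$ and let $F:\mathcal K^n\to[0,+\infty]$ (for instance with values in $[0,+\infty)$) be - $\alpha$-homogeneous: $F(tK)=t^\alpha F(K)$ for all $K\in\mathcal K^n$ and $t>0$; - continuous with respect to the Hausdorff distance; - invariant under rigid motions (compositions of rotations and translations); - such that the Brunn–Minkowski inequality holds: $$F^{1/\alpha}(K+L)\ \ge\ F^{1/\alpha}(K)+F^{1/\alpha}(L)\qquad\forall K,L\in\mathcal K^n, \tag{BM}$$ with the usual conventions $0^{s}=+\infty$, $(+\infty)^{s}=0$ for $s<0$, and $0^s=0$, $(+\infty)^s=+\infty$ for $s>0$. Consider $$\mathcal E(K)=\frac{F^{1/\alpha}(K)}{M(K)}$$ on the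 bodies $K\in\mathcal K^n$ that are not single points (equivalently, $M(K)>0$). Then: 1. the maximum of $\mathcal E$ is attained on balls: every closed ball of positive radius is a maximizer of $\mathcal E$; 2. if the inequality in (BM) is strict for all non-homothetic $K,L\in\mathcal K^n$, then $\mathcal E$ attains its maximum only on balls; moreover, if $n=2$, every minimizer of $\mathcal E$ is either a (nondegenerate) triangle or a segment. Here $K$ and $L$ are homothetic if $K=cL+x$ or $L=cK+x$ for some $c\ge 0$ and $x\in\mathbb R^n$; in particular a single point is homothetic to every convex body. -/

import Mathlib

open scoped ENNReal Pointwise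

/-- Euclidean space `ℝⁿ`. Compact convex nonempty subsets of it are Mathlib's `ConvexBody (Euc n)`,
with Minkowski addition, dilations, and the topology of the Hausdorff distance. -/
abbrev Euc (n : ℕ) : Type := EuclideanSpace ℝ (Fin n)

namespace ConvexShape

variable {n : ℕ}

/-- The support function `h(K)(ν) = sup_{x ∈ K} x · ν`. -/
noncomputable def supportFun (K : ConvexBody (Euc n)) (ν : Euc n) : ℝ :=
  sSup ((fun x : Euc n => inner ℝ x ν) '' (K : Set (Euc n)))

/-- The mean width `M(K) = 2 / H^{n-1}(S^{n-1}) * ∫_{S^{n-1}} h(K) dH^{n-1}`. -/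
noncomputable def meanWidth (K : ConvexBody (Euc n)) : ℝ :=
  2 / (MeasureTheory.Measure.hausdorffMeasure ((n : ℝ) - 1)
        (Metric.sphere (0 : Euc n) 1)).toReal *
    ∫ ν in Metric.sphere (0 : Euc n) 1, supportFun K ν
      ∂(MeasureTheory.Measure.hausdorffMeasure ((n : ℝ) - 1))

/-- `F(tK) = t^α F(K)` for all convex bodies `K` and all `t > 0`. -/
def IsHomogeneous (α : ℝ) (F : ConvexBody (Euc n) → ℝ≥0∞) : Prop :=
  ∀ (K : ConvexBody (Euc n)) (t : ℝ), 0 < t → F (t • K) = ENNReal.ofReal t ^ α * F K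

/-- Invariance under rigid motions `y ↦ f y + x`, with `f` a rotation (a linear isometry of
determinant one) and `x` a vector. -/
def IsRigidMotionInvariant (F : ConvexBody (Euc n) → ℝ≥0∞) : Prop :=
  ∀ (f : Euc n ≃ₗᵢ[ℝ] Euc n) (x : Euc n) (K L : ConvexBody (Euc n)),
    LinearMap.det (f.toLinearEquiv : Euc n →ₗ[ℝ] Euc n) = 1 →
    (L : Set (Euc n)) = (fun y => f y + x) '' (K : Set (Euc n)) → F L = F K

/-- The Brunn-Minkowski inequality for an `α`-homogeneous functional. -/
def SatisfiesBrunnMinkowski (α : ℝ) (F : ConvexBody (Euc n) → ℝ≥0∞) : Prop :=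
  ∀ K L : ConvexBody (Euc n), F K ^ (1 / α) + F L ^ (1 / α) ≤ F (K + L) ^ (1 / α)

/-- Two convex bodies are homothetic if one of them is `c K + x` for the other body `K`, some vector
`x` and some `c ≥ 0`. As usual, a single point is homothetic to every convex body (`c = 0`). -/
def Homothetic (K L : ConvexBody (Euc n)) : Prop :=
  ∃ (c : ℝ) (x : Euc n), 0 ≤ c ∧
    ((K : Set (Euc n)) = (fun y => c • y + x) '' (L : Set (Euc n)) ∨
      (L : Set (Euc n)) = (fun y => c • y + x) '' (K : Set (Euc n)))

/-- The Brunn-Minkowski inequality is strict for non-homothetic convex bodies. -/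
def BrunnMinkowskiStrict (α : ℝ) (F : ConvexBody (Euc n) → ℝ≥0∞) : Prop :=
  ∀ K L : ConvexBody (Euc n), ¬ Homothetic K L →
    F K ^ (1 / α) + F L ^ (1 / α) < F (K + L) ^ (1 / α)

/-- The quotient `F^{1/α}(K) / M(K)`; it is meaningful when `K` is not a single point. -/
noncomputable def shapeQuotient (α : ℝ) (F : ConvexBody (Euc n) → ℝ≥0∞)
    (K : ConvexBody (Euc n)) : ℝ≥0∞ :=
  F K ^ (1 / α) / ENNReal.ofReal (meanWidth K)

/-- The convex bodies with more than one point, that is, those of positive mean width. -/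
def nontrivialBodies (n : ℕ) : Set (ConvexBody (Euc n)) :=
  {K | (K : Set (Euc n)).Nontrivial}

/-- `K` is a maximizer of the quotient among the bodies where the quotient is defined. -/
def IsMaximizer (α : ℝ) (F : ConvexBody (Euc n) → ℝ≥0∞) (K : ConvexBody (Euc n)) : Prop :=
  K ∈ nontrivialBodies n ∧
    ∀ L ∈ nontrivialBodies n, shapeQuotient α F L ≤ shapeQuotient α F K

/-- `K` is a minimizer of the quotient among the bodies where the quotient is defined. -/
def IsMinimizer (α : ℝ) (F : ConvexBody (Euc n) → ℝ≥0∞) (K : ConvexBody (Euc n)) : Prop :=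
  K ∈ nontrivialBodies n ∧
    ∀ L ∈ nontrivialBodies n, shapeQuotient α F K ≤ shapeQuotient α F L

/-- `K` is a closed ball of positive radius. -/
def IsBall (K : ConvexBody (Euc n)) : Prop :=
  ∃ (x : Euc n) (r : ℝ), 0 < r ∧ (K : Set (Euc n)) = Metric.closedBall x r

/-- `K` is a nondegenerate triangle. -/
def IsTriangle (K : ConvexBody (Euc n)) : Prop :=
  ∃ p : Fin 3 → Euc n, AffineIndependent ℝ p ∧
    (K : Set (Euc n)) = convexHull ℝ (Set.range p)

/-- `K` is a segment with distinct endpoints. -/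
def IsSegment (K : ConvexBody (Euc n)) : Prop :=
  ∃ a b : Euc n, a ≠ b ∧ (K : Set (Euc n)) = segment ℝ a b

end ConvexShape

/-! Put `G = F^{1/α}`. It is 1-homogeneous, invariant under rigid motions and superadditive, while
mean width is additive, 1-homogeneous and invariant. The quotient `G / M` therefore behaves like a
concave functional divided by a linear one.

Balls maximize: replacing a body by a Minkowski average of rotated copies keeps `M` and does not
decrease `G`. Suitable averages bring the support function arbitrarily close to a constant
(`exists_abs_supportFun_sub_le`), so by continuity `G` is largest on the ball of the same mean width
(`IsConcaveShape.le_ballBody`). On the line every nontrivial body is already a ball.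

Only balls maximize in the strict case: if a rotated copy of a maximizer were not homothetic to it,
their sum would have a larger quotient. Equal mean widths turn homothety into translation, and a
body whose rotated copies are all translates of it is a ball (`isBall_of_rotate_eq_translate`).

Planar minimizers: strictness forces every decomposition `K = L₁ + L₂` of a minimizer to be
homothetic (`homothetic_of_isMinimizer`). A planar body with four exposed points has a
non-homothetic decomposition: cut its boundary into four arcs by normal angle, rescale the arcs by
factors in `[0, 1]` that keep the curve closed, and use the complementary factors for the other
summand (`exists_add_eq_not_homothetic`). Hence a minimizer has at most three exposed points, whose
convex hull it is. -/

namespace ConvexShape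

variable {n : ℕ}

/-! ### Support functions of convex bodies. -/

lemma bddAbove_inner_image (K : ConvexBody (Euc n)) (ν : Euc n) :
    BddAbove ((fun x : Euc n => inner ℝ x ν) '' (K : Set (Euc n))) :=
  (K.isCompact.image (by fun_prop)).bddAbove

lemma inner_le_supportFun {K : ConvexBody (Euc n)} {x : Euc n} (hx : x ∈ K) (ν : Euc n) :
    inner ℝ x ν ≤ supportFun K ν :=
  le_csSup (bddAbove_inner_image K ν) ⟨x, hx, rfl⟩

lemma supportFun_le {K : ConvexBody (Euc n)} {ν : Euc n} {c : ℝ}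
    (h : ∀ x ∈ K, inner ℝ x ν ≤ c) : supportFun K ν ≤ c := by
  refine csSup_le (K.nonempty.image _) ?_
  rintro _ ⟨x, hx, rfl⟩
  exact h x hx

lemma exists_supportFun_eq (K : ConvexBody (Euc n)) (ν : Euc n) :
    ∃ x ∈ K, supportFun K ν = inner ℝ x ν := by
  obtain ⟨x, hx, h⟩ := K.isCompact.exists_sSup_image_eq K.nonempty
    (f := fun x : Euc n => inner ℝ x ν) (by fun_prop)
  exact ⟨x, hx, h⟩

lemma supportFun_eq_of_mem {K : ConvexBody (Euc n)} {x ν : Euc n} (hx : x ∈ K)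
    (h : ∀ y ∈ K, inner ℝ y ν ≤ inner ℝ x ν) : supportFun K ν = inner ℝ x ν :=
  le_antisymm (supportFun_le h) (inner_le_supportFun hx ν)

lemma supportFun_add (K L : ConvexBody (Euc n)) (ν : Euc n) :
    supportFun (K + L) ν = supportFun K ν + supportFun L ν := by
  obtain ⟨x, hx, h1⟩ := exists_supportFun_eq K ν
  obtain ⟨y, hy, h2⟩ := exists_supportFun_eq L ν
  rw [h1, h2, ← inner_add_left]
  refine supportFun_eq_of_mem (Set.add_mem_add hx hy) ?_
  rintro _ ⟨a, ha, b, hb, rfl⟩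
  simp only [inner_add_left]
  exact add_le_add (h1 ▸ inner_le_supportFun ha ν) (h2 ▸ inner_le_supportFun hb ν)

lemma supportFun_zero (ν : Euc n) : supportFun (0 : ConvexBody (Euc n)) ν = 0 := by
  rw [supportFun_eq_of_mem (x := 0) (Set.mem_zero.2 rfl) ?_, inner_zero_left]
  intro y hy
  have : y = 0 := hy
  rw [this]

lemma supportFun_sum {ι : Type*} (s : Finset ι) (K : ι → ConvexBody (Euc n)) (ν : Euc n) :
    supportFun (∑ i ∈ s, K i) ν = ∑ i ∈ s, supportFun (K i) ν := by
  classical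
  induction s using Finset.induction_on with
  | empty => simp [supportFun_zero]
  | insert i s hi ih => rw [Finset.sum_insert hi, Finset.sum_insert hi, supportFun_add, ih]

/-- The support function of a body `a • f(K) + x`, with `f` a linear isometry. -/
lemma supportFun_of_image (f : Euc n ≃ₗᵢ[ℝ] Euc n) {c : ℝ} (hc : 0 ≤ c) (x : Euc n)
    {K L : ConvexBody (Euc n)}
    (h : (L : Set (Euc n)) = (fun y => c • f y + x) '' (K : Set (Euc n))) (ν : Euc n) :
    supportFun L ν = c * supportFun K (f.symm ν) + inner ℝ x ν := by
  have key : ∀ y, inner ℝ (c • f y + x) ν = c * inner ℝ y (f.symm ν) + inner ℝ x ν := by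
    intro y
    rw [inner_add_left, real_inner_smul_left, ← f.inner_map_map y, f.apply_symm_apply]
  obtain ⟨y, hy, h1⟩ := exists_supportFun_eq K (f.symm ν)
  rw [h1, ← key]
  refine supportFun_eq_of_mem (h ▸ ⟨y, hy, rfl⟩ : _ ∈ (L : Set (Euc n))) ?_
  intro z hz
  obtain ⟨w, hw, rfl⟩ : z ∈ (fun y => c • f y + x) '' (K : Set (Euc n)) := h ▸ hz
  simp only [key]
  have := inner_le_supportFun hw (f.symm ν)
  rw [h1] at this
  gcongr

lemma supportFun_of_homothety {c : ℝ} (hc : 0 ≤ c) (x : Euc n) {K L : ConvexBody (Euc n)}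
    (h : (L : Set (Euc n)) = (fun y => c • y + x) '' (K : Set (Euc n))) (ν : Euc n) :
    supportFun L ν = c * supportFun K ν + inner ℝ x ν :=
  supportFun_of_image (LinearIsometryEquiv.refl ℝ _) hc x h ν

lemma supportFun_smul {c : ℝ} (hc : 0 ≤ c) (K : ConvexBody (Euc n)) (ν : Euc n) :
    supportFun (c • K) ν = c * supportFun K ν := by
  rw [supportFun_of_homothety hc 0 (K := K) (by simp [← Set.image_smul]), inner_zero_left, add_zero]

lemma supportFun_smul_right {c : ℝ} (hc : 0 ≤ c) (K : ConvexBody (Euc n)) (ν : Euc n) :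
    supportFun K (c • ν) = c * supportFun K ν := by
  obtain ⟨x, hx, h⟩ := exists_supportFun_eq K ν
  rw [h, ← real_inner_smul_right]
  refine supportFun_eq_of_mem hx fun y hy => ?_
  rw [real_inner_smul_right, real_inner_smul_right, ← h]
  exact mul_le_mul_of_nonneg_left (inner_le_supportFun hy ν) hc

/-- The translate `K + x`. -/
def translate (K : ConvexBody (Euc n)) (x : Euc n) : ConvexBody (Euc n) where
  carrier := (fun y => y + x) '' (K : Set (Euc n))
  convex' := by simpa [add_comm] using K.convex.translate x
  isCompact' := K.isCompact.image (by fun_prop)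
  nonempty' := K.nonempty.image _

lemma supportFun_translate (K : ConvexBody (Euc n)) (x ν : Euc n) :
    supportFun (translate K x) ν = supportFun K ν + inner ℝ x ν := by
  rw [supportFun_of_homothety zero_le_one x (K := K) (by simp [translate]), one_mul]

/-- The image of a convex body under a linear isometry. -/
def rotate (f : Euc n ≃ₗᵢ[ℝ] Euc n) (K : ConvexBody (Euc n)) : ConvexBody (Euc n) where
  carrier := f '' (K : Set (Euc n))
  convex' := K.convex.linear_image f.toLinearEquiv.toLinearMap
  isCompact' := K.isCompact.image f.continuous
  nonempty' := K.nonempty.image _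

lemma supportFun_rotate (f : Euc n ≃ₗᵢ[ℝ] Euc n) (K : ConvexBody (Euc n)) (ν : Euc n) :
    supportFun (rotate f K) ν = supportFun K (f.symm ν) := by
  rw [supportFun_of_image f zero_le_one 0 (K := K) (by simp [rotate]), one_mul, inner_zero_left,
    add_zero]

/-- The closed ball with centre `x` and radius `r ≥ 0`. -/
def ballBody (x : Euc n) {r : ℝ} (hr : 0 ≤ r) : ConvexBody (Euc n) where
  carrier := Metric.closedBall x r
  convex' := convex_closedBall x r
  isCompact' := isCompact_closedBall x r
  nonempty' := Metric.nonempty_closedBall.2 hr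

lemma supportFun_of_closedBall {x : Euc n} {r : ℝ} (hr : 0 ≤ r) {K : ConvexBody (Euc n)}
    (hK : (K : Set (Euc n)) = Metric.closedBall x r) {ν : Euc n} (hν : ‖ν‖ = 1) :
    supportFun K ν = r + inner ℝ x ν := by
  have h : inner ℝ (x + r • ν) ν = r + inner ℝ x ν := by
    rw [inner_add_left, real_inner_smul_left, real_inner_self_eq_norm_sq, hν]; ring
  rw [← h]
  refine supportFun_eq_of_mem ?_ fun y hy => ?_
  · rw [← SetLike.mem_coe, hK, mem_closedBall_iff_norm]
    simp [norm_smul, hν, abs_of_nonneg hr]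
  · rw [← SetLike.mem_coe, hK, mem_closedBall_iff_norm] at hy
    have h2 := real_inner_le_norm (y - x) ν
    rw [hν, mul_one, inner_sub_left] at h2
    rw [h]
    linarith

lemma supportFun_ballBody (x : Euc n) {r : ℝ} (hr : 0 ≤ r) {ν : Euc n} (hν : ‖ν‖ = 1) :
    supportFun (ballBody x hr) ν = r + inner ℝ x ν :=
  supportFun_of_closedBall hr rfl hν

/-- A point outside `K` is separated from it by Hahn–Banach; the separating vector is nonzero and
can be normalized because the support function is positively homogeneous. -/
lemma mem_of_forall_inner_le {K : ConvexBody (Euc n)} {x : Euc n}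
    (h : ∀ ν : Euc n, ‖ν‖ = 1 → inner ℝ x ν ≤ supportFun K ν) : x ∈ K := by
  by_contra hx
  obtain ⟨f, u, hf, hu⟩ := geometric_hahn_banach_closed_point K.convex K.isClosed hx
  set w : Euc n := (InnerProductSpace.toDual ℝ (Euc n)).symm f
  have hw : ∀ y, f y = inner ℝ y w := by
    intro y
    rw [real_inner_comm]
    exact (InnerProductSpace.toDual_symm_apply).symm
  have hlt : supportFun K w < inner ℝ x w := by
    obtain ⟨y, hy, e⟩ := exists_supportFun_eq K w
    rw [e, ← hw, ← hw]
    exact (hf y hy).trans hu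
  have hw0 : w ≠ 0 := by
    intro h0
    obtain ⟨y, hy⟩ := K.nonempty
    have := inner_le_supportFun hy w
    rw [h0, inner_zero_right] at this hlt
    linarith
  have hpos : 0 < ‖w‖ := norm_pos_iff.2 hw0
  have h1 := h (‖w‖⁻¹ • w) (by rw [norm_smul, norm_inv, norm_norm, inv_mul_cancel₀ hpos.ne'])
  rw [real_inner_smul_right, supportFun_smul_right (inv_nonneg.2 hpos.le)] at h1
  exact absurd (le_of_mul_le_mul_left h1 (inv_pos.2 hpos)) (not_le.2 hlt)

lemma subset_of_supportFun_le {K L : ConvexBody (Euc n)}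
    (h : ∀ ν : Euc n, ‖ν‖ = 1 → supportFun K ν ≤ supportFun L ν) :
    (K : Set (Euc n)) ⊆ L := fun _ hx =>
  mem_of_forall_inner_le fun ν hν => (inner_le_supportFun hx ν).trans (h ν hν)

lemma eq_of_supportFun_eq {K L : ConvexBody (Euc n)}
    (h : ∀ ν : Euc n, ‖ν‖ = 1 → supportFun K ν = supportFun L ν) : K = L :=
  ConvexBody.ext ((subset_of_supportFun_le fun ν hν => (h ν hν).le).antisymm
    (subset_of_supportFun_le fun ν hν => (h ν hν).ge))

/-- The bound says that each body lies in the other one enlarged by a ball of radius `ε`, since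
inclusion can be read off support functions. -/
lemma dist_le_of_supportFun {K L : ConvexBody (Euc n)} {ε : ℝ} (hε : 0 ≤ ε)
    (h : ∀ ν : Euc n, ‖ν‖ = 1 → |supportFun K ν - supportFun L ν| ≤ ε) : dist K L ≤ ε := by
  have key : ∀ K L : ConvexBody (Euc n),
      (∀ ν : Euc n, ‖ν‖ = 1 → |supportFun K ν - supportFun L ν| ≤ ε) →
      ∀ x ∈ (K : Set (Euc n)), ∃ y ∈ (L : Set (Euc n)), dist x y ≤ ε := by
    intro K L h x hx
    have hx' : x ∈ L + ballBody 0 hε := by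
      refine subset_of_supportFun_le (fun ν hν => ?_) hx
      rw [supportFun_add, supportFun_ballBody _ _ hν, inner_zero_left]
      linarith [(abs_le.1 (h ν hν)).2]
    obtain ⟨y, hy, z, hz, rfl⟩ := hx'
    refine ⟨y, hy, ?_⟩
    have hz' : dist z 0 ≤ ε := hz
    simpa using hz'
  exact Metric.hausdorffDist_le_of_mem_dist hε (key K L h)
    (key L K fun ν hν => by rw [abs_sub_comm]; exact h ν hν)

/-- The point extremal for `ν` is a competitor for `μ`; its norm is the Lipschitz constant. -/
lemma supportFun_sub_le {K : ConvexBody (Euc n)} {R : ℝ} (hK : ∀ x ∈ K, ‖x‖ ≤ R) (ν μ : Euc n) :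
    supportFun K ν - supportFun K μ ≤ R * ‖ν - μ‖ := by
  obtain ⟨x, hx, h⟩ := exists_supportFun_eq K ν
  have h1 := inner_le_supportFun hx μ
  have h2 := real_inner_le_norm x (ν - μ)
  rw [inner_sub_right] at h2
  have h3 := mul_le_mul_of_nonneg_right (hK x hx) (norm_nonneg (ν - μ))
  linarith

lemma exists_norm_le (K : ConvexBody (Euc n)) : ∃ R : ℝ, 0 ≤ R ∧ ∀ x ∈ K, ‖x‖ ≤ R := by
  obtain ⟨C, hC, h⟩ := K.isBounded.exists_pos_norm_le
  exact ⟨C, hC.le, h⟩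

lemma continuous_supportFun (K : ConvexBody (Euc n)) : Continuous (supportFun K) := by
  obtain ⟨R, hR, h⟩ := exists_norm_le K
  refine (LipschitzWith.of_dist_le_mul (K := R.toNNReal) fun ν μ => ?_).continuous
  rw [Real.dist_eq, dist_eq_norm, Real.coe_toNNReal R hR, abs_le]
  have h1 := supportFun_sub_le h ν μ
  have h2 := supportFun_sub_le h μ ν
  rw [norm_sub_rev] at h2
  constructor <;> linarith

lemma neg_supportFun_neg_le (K : ConvexBody (Euc n)) (ν : Euc n) :
    - supportFun K (-ν) ≤ supportFun K ν := by
  obtain ⟨x, hx⟩ := K.nonempty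
  have h1 := inner_le_supportFun hx ν
  have h2 := inner_le_supportFun hx (-ν)
  rw [inner_neg_right] at h2
  linarith

end ConvexShape

/-! ### Hausdorff measure on the sphere: positivity, finiteness, invariance. -/

namespace ConvexShape

variable {n : ℕ}

open MeasureTheory Metric Set Module

section SphereMeasure

variable {m : ℕ}

/-- The graph parametrization of the open hemisphere around a unit vector `v`. -/
noncomputable def hemisphereChart (v : Euc (m + 1)) (w : (Submodule.span ℝ {v})ᗮ) : Euc (m + 1) :=
  w + Real.sqrt (1 - ‖w‖ ^ 2) • v

lemma finrank_orthogonal_unit {v : Euc (m + 1)} (hv : ‖v‖ = 1) :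
    finrank ℝ (Submodule.span ℝ {v})ᗮ = m :=
  haveI : Fact (finrank ℝ (Euc (m + 1)) = m + 1) := ⟨by simp⟩
  Submodule.finrank_orthogonal_span_singleton (norm_ne_zero_iff.1 (by rw [hv]; norm_num))

lemma hemisphereChart_mem {v : Euc (m + 1)} (hv : ‖v‖ = 1) {w : (Submodule.span ℝ {v})ᗮ}
    (hw : ‖w‖ ≤ 1) : hemisphereChart v w ∈ sphere (0 : Euc (m + 1)) 1 := by
  have h0 : inner ℝ (w : Euc (m + 1)) (Real.sqrt (1 - ‖w‖ ^ 2) • v) = 0 := by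
    rw [real_inner_smul_right, Submodule.mem_orthogonal_singleton_iff_inner_left.1 w.2, mul_zero]
  have h1 := norm_add_sq_eq_norm_sq_add_norm_sq_of_inner_eq_zero _ _ h0
  have h2 : 0 ≤ 1 - ‖w‖ ^ 2 := by nlinarith [norm_nonneg w]
  rw [norm_smul, hv, mul_one, Real.norm_eq_abs, abs_of_nonneg (Real.sqrt_nonneg _),
    Real.mul_self_sqrt h2] at h1
  have h3 : ‖hemisphereChart v w‖ * ‖hemisphereChart v w‖ = 1 := by
    unfold hemisphereChart
    rw [h1, Submodule.coe_norm]; ring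
  rw [mem_sphere_zero_iff_norm]
  nlinarith [norm_nonneg (hemisphereChart v w)]

lemma orthogonalProjection_hemisphereChart (v : Euc (m + 1)) (w : (Submodule.span ℝ {v})ᗮ) :
    (Submodule.span ℝ {v})ᗮ.orthogonalProjectionOnto (hemisphereChart v w) = w := by
  unfold hemisphereChart
  rw [map_add, map_smul, Submodule.orthogonalProjectionOnto_mem_subspace_eq_self,
    Submodule.orthogonalProjectionOnto_orthogonal_apply_eq_zero
      (Submodule.mem_span_singleton_self v), smul_zero, add_zero]

lemma hemisphereChart_orthogonalProjection {v y : Euc (m + 1)} (hv : ‖v‖ = 1) (hy : ‖y‖ = 1)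
    (hvy : 0 < inner ℝ v y) :
    hemisphereChart v ((Submodule.span ℝ {v})ᗮ.orthogonalProjectionOnto y) = y := by
  have hP : ((Submodule.span ℝ {v})ᗮ.orthogonalProjectionOnto y : Euc (m + 1))
      = y - inner ℝ v y • v := by
    have := Submodule.starProjection_add_starProjection_orthogonal (K := Submodule.span ℝ {v}) y
    rw [Submodule.starProjection_unit_singleton ℝ hv] at this
    rw [← Submodule.starProjection_apply, eq_sub_iff_add_eq]
    exact (add_comm _ _).trans this
  have hn : 1 - ‖(Submodule.span ℝ {v})ᗮ.orthogonalProjectionOnto y‖ ^ 2 = (inner ℝ v y) ^ 2 := by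
    rw [Submodule.coe_norm, hP, norm_sub_sq_real, norm_smul, real_inner_smul_right, hv, hy,
      real_inner_comm, Real.norm_eq_abs, mul_one, sq_abs]
    ring
  unfold hemisphereChart
  rw [hn, Real.sqrt_sq hvy.le, hP, sub_add_cancel]

/-- Orthogonal projection to a hyperplane does not increase Hausdorff measure, and it maps the
sphere onto a set containing the unit ball of the hyperplane. -/
lemma hausdorffMeasure_sphere_pos : 0 < μH[(m : ℝ)] (sphere (0 : Euc (m + 1)) 1) := by
  obtain ⟨v, hv⟩ := exists_norm_eq (Euc (m + 1)) zero_le_one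
  set W := (Submodule.span ℝ {v})ᗮ
  have h1 := hausdorffMeasure_orthogonalProjectionOnto_le W m (sphere (0 : Euc (m + 1)) 1)
    m.cast_nonneg
  refine lt_of_lt_of_le ?_ h1
  have hsub : closedBall (0 : W) 1 ⊆ W.orthogonalProjectionOnto '' sphere (0 : Euc (m + 1)) 1 := by
    intro w hw
    exact ⟨_, hemisphereChart_mem hv (mem_closedBall_zero_iff.1 hw),
      orthogonalProjection_hemisphereChart v w⟩
  refine lt_of_lt_of_le ?_ (measure_mono hsub)
  have hm : (m : ℝ) = (finrank ℝ W : ℝ) := by rw [finrank_orthogonal_unit hv]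
  rw [hm]
  exact measure_closedBall_pos _ _ one_pos

/-- By compactness a neighbourhood of each point suffices. Near `v` the sphere is the image of a
bounded piece of the tangent hyperplane under a chart that is `C¹` at `0`, hence Lipschitz there. -/
lemma hausdorffMeasure_sphere_lt_top : μH[(m : ℝ)] (sphere (0 : Euc (m + 1)) 1) < ∞ := by
  refine (isCompact_sphere _ _).measure_lt_top_of_nhdsWithin fun v hv => ?_
  rw [mem_sphere_zero_iff_norm] at hv
  set W := (Submodule.span ℝ {v})ᗮ
  have hC : ContDiffAt ℝ 1 (hemisphereChart v) 0 := by
    unfold hemisphereChart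
    refine ContDiffAt.add (W.subtypeL.contDiff.contDiffAt) ?_
    exact (ContDiffAt.sqrt (contDiffAt_const.sub (contDiff_norm_sq ℝ).contDiffAt) (by simp)).smul contDiffAt_const
  obtain ⟨C, t, ht, hL⟩ := hC.exists_lipschitzOnWith
  have hm : (m : ℝ) = (finrank ℝ W : ℝ) := by rw [finrank_orthogonal_unit hv]
  refine ⟨hemisphereChart v '' (t ∩ closedBall 0 1), ?_, ?_⟩
  · have hP : Filter.Tendsto W.orthogonalProjectionOnto (nhds v) (nhds 0) := by
      have := (W.orthogonalProjectionOnto.continuous).tendsto v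
      rwa [Submodule.orthogonalProjectionOnto_orthogonal_apply_eq_zero
        (Submodule.mem_span_singleton_self v)] at this
    have h1 : ∀ᶠ y in nhds v, W.orthogonalProjectionOnto y ∈ t ∩ closedBall 0 1 :=
      hP (Filter.inter_mem ht (closedBall_mem_nhds _ one_pos))
    have h2 : ∀ᶠ y in nhds v, 0 < inner ℝ v y :=
      (continuous_const.inner continuous_id).continuousAt.eventually_const_lt
        (by simp [hv])
    filter_upwards [nhdsWithin_le_nhds h1, nhdsWithin_le_nhds h2, self_mem_nhdsWithin]
      with y hy1 hy2 hy3
    exact ⟨_, hy1, hemisphereChart_orthogonalProjection hv (mem_sphere_zero_iff_norm.1 hy3) hy2⟩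
  · refine ((hL.mono inter_subset_left).hausdorffMeasure_image_le m.cast_nonneg).trans_lt ?_
    refine ENNReal.mul_lt_top (by simp) ?_
    refine (measure_mono inter_subset_right).trans_lt ?_
    rw [hm]
    exact measure_closedBall_lt_top

end SphereMeasure

lemma sphere_measure_pos (hn : 1 ≤ n) : 0 < μH[(n : ℝ) - 1] (sphere (0 : Euc n) 1) := by
  obtain ⟨m, rfl⟩ := Nat.exists_eq_add_of_le' hn
  simpa using hausdorffMeasure_sphere_pos (m := m)

lemma sphere_measure_ne_top (hn : 1 ≤ n) : μH[(n : ℝ) - 1] (sphere (0 : Euc n) 1) ≠ ∞ := by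
  obtain ⟨m, rfl⟩ := Nat.exists_eq_add_of_le' hn
  simpa using (hausdorffMeasure_sphere_lt_top (m := m)).ne

lemma integrableOn_sphere (hn : 1 ≤ n) {g : Euc n → ℝ} (hg : Continuous g) :
    IntegrableOn g (sphere (0 : Euc n) 1) μH[(n : ℝ) - 1] := by
  obtain ⟨C, hC⟩ := ((isCompact_sphere (0 : Euc n) 1).image hg).isBounded.exists_norm_le
  refine Measure.integrableOn_of_bounded (M := C) (sphere_measure_ne_top hn)
    hg.aestronglyMeasurable ?_
  refine (ae_restrict_iff' isClosed_sphere.measurableSet).2 (Filter.Eventually.of_forall fun x hx => ?_)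
  exact hC _ ⟨x, hx, rfl⟩

/-- Isometries preserve Hausdorff measure. This is the source of every invariance of the mean width.
-/
lemma setIntegral_sphere_comp (f : Euc n ≃ₗᵢ[ℝ] Euc n) (g : Euc n → ℝ) :
    ∫ ν in sphere (0 : Euc n) 1, g (f ν) ∂μH[(n : ℝ) - 1]
      = ∫ ν in sphere (0 : Euc n) 1, g ν ∂μH[(n : ℝ) - 1] := by
  have h := (f.toIsometryEquiv.measurePreserving_hausdorffMeasure ((n : ℝ) - 1))
  have hpre : f.toIsometryEquiv ⁻¹' sphere (0 : Euc n) 1 = sphere (0 : Euc n) 1 := by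
    ext x; simp
  have h2 := h.setIntegral_preimage_emb f.toIsometryEquiv.toHomeomorph.measurableEmbedding g
    (sphere (0 : Euc n) 1)
  rw [hpre] at h2
  exact h2

/-! ### Mean width. -/

lemma meanWidth_add (hn : 1 ≤ n) (K L : ConvexBody (Euc n)) :
    meanWidth (K + L) = meanWidth K + meanWidth L := by
  unfold meanWidth
  simp only [supportFun_add]
  rw [integral_add (integrableOn_sphere hn (continuous_supportFun K))
    (integrableOn_sphere hn (continuous_supportFun L)), mul_add]

lemma meanWidth_smul {c : ℝ} (hc : 0 ≤ c) (K : ConvexBody (Euc n)) :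
    meanWidth (c • K) = c * meanWidth K := by
  unfold meanWidth
  simp only [supportFun_smul hc]
  rw [integral_const_mul]
  ring

lemma meanWidth_zero : meanWidth (0 : ConvexBody (Euc n)) = 0 := by
  unfold meanWidth
  simp [supportFun_zero]

lemma meanWidth_sum (hn : 1 ≤ n) {ι : Type*} (s : Finset ι) (K : ι → ConvexBody (Euc n)) :
    meanWidth (∑ i ∈ s, K i) = ∑ i ∈ s, meanWidth (K i) := by
  classical
  induction s using Finset.induction_on with
  | empty => simp [meanWidth_zero]
  | insert i s hi ih => rw [Finset.sum_insert hi, Finset.sum_insert hi, meanWidth_add hn, ih]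

lemma meanWidth_rotate (f : Euc n ≃ₗᵢ[ℝ] Euc n) (K : ConvexBody (Euc n)) :
    meanWidth (rotate f K) = meanWidth K := by
  unfold meanWidth
  simp only [supportFun_rotate]
  rw [setIntegral_sphere_comp f.symm (supportFun K)]

/-- The extra term `⟪x, ν⟫` is odd in `ν`, so its integral vanishes. -/
lemma meanWidth_translate (hn : 1 ≤ n) (K : ConvexBody (Euc n)) (x : Euc n) :
    meanWidth (translate K x) = meanWidth K := by
  have h : ∫ ν in sphere (0 : Euc n) 1, inner ℝ x ν ∂μH[(n : ℝ) - 1] = 0 := by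
    have := setIntegral_sphere_comp (LinearIsometryEquiv.neg ℝ) (fun ν : Euc n => inner ℝ x ν)
    simp only [LinearIsometryEquiv.coe_neg, inner_neg_right, integral_neg] at this
    linarith
  unfold meanWidth
  simp only [supportFun_translate]
  rw [integral_add (integrableOn_sphere hn (continuous_supportFun K))
    (integrableOn_sphere hn (by fun_prop)), h, add_zero]

lemma meanWidth_le {c : ℝ} (hn : 1 ≤ n) {K : ConvexBody (Euc n)}
    (h : ∀ ν : Euc n, ‖ν‖ = 1 → supportFun K ν ≤ c) : meanWidth K ≤ 2 * c := by
  have hA := ENNReal.toReal_pos (sphere_measure_pos hn).ne' (sphere_measure_ne_top hn)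
  have h1 := setIntegral_mono_on (integrableOn_sphere hn (continuous_supportFun K))
    (integrableOn_sphere hn continuous_const) isClosed_sphere.measurableSet
    (fun ν hν => h ν (mem_sphere_zero_iff_norm.1 hν))
  rw [setIntegral_const, smul_eq_mul, Measure.real] at h1
  unfold meanWidth
  rw [div_mul_eq_mul_div, div_le_iff₀ hA]
  nlinarith

lemma le_meanWidth {c : ℝ} (hn : 1 ≤ n) {K : ConvexBody (Euc n)}
    (h : ∀ ν : Euc n, ‖ν‖ = 1 → c ≤ supportFun K ν) : 2 * c ≤ meanWidth K := by
  have hA := ENNReal.toReal_pos (sphere_measure_pos hn).ne' (sphere_measure_ne_top hn)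
  have h1 := setIntegral_mono_on (integrableOn_sphere hn continuous_const)
    (integrableOn_sphere hn (continuous_supportFun K)) isClosed_sphere.measurableSet
    (fun ν hν => h ν (mem_sphere_zero_iff_norm.1 hν))
  rw [setIntegral_const, smul_eq_mul, Measure.real] at h1
  unfold meanWidth
  rw [div_mul_eq_mul_div, le_div_iff₀ hA]
  nlinarith

lemma meanWidth_of_closedBall (hn : 1 ≤ n) {K : ConvexBody (Euc n)} {x : Euc n} {r : ℝ}
    (hr : 0 ≤ r) (hK : (K : Set (Euc n)) = closedBall x r) : meanWidth K = 2 * r := by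
  have h1 : K = translate (ballBody 0 hr) x := by
    refine eq_of_supportFun_eq fun ν hν => ?_
    rw [supportFun_of_closedBall hr hK hν, supportFun_translate, supportFun_ballBody _ _ hν,
      inner_zero_left, add_zero]
  rw [h1, meanWidth_translate hn]
  refine le_antisymm (meanWidth_le hn fun ν hν => ?_) (le_meanWidth hn fun ν hν => ?_) <;>
  simp [supportFun_ballBody _ _ hν]

/-- A reflection that exchanges two vectors of equal norm. -/
lemma exists_isometry_apply_eq {u v : Euc n} (h : ‖u‖ = ‖v‖) :
    ∃ f : Euc n ≃ₗᵢ[ℝ] Euc n, f u = v :=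
  ⟨_, Submodule.reflection_sub h⟩

/-- If one patch of the sphere were null, reflections would carry it to a null neighbourhood of
every point, and by compactness the whole sphere would be null. -/
lemma measure_inter_sphere_pos (hn : 1 ≤ n) {U : Set (Euc n)} (hU : IsOpen U) {u : Euc n}
    (hu : ‖u‖ = 1) (huU : u ∈ U) : 0 < μH[(n : ℝ) - 1] (U ∩ sphere (0 : Euc n) 1) := by
  rw [pos_iff_ne_zero]
  intro h0
  refine (sphere_measure_pos hn).ne' ?_
  refine (isCompact_sphere _ _).measure_zero_of_nhdsWithin fun x hx => ?_
  rw [mem_sphere_zero_iff_norm] at hx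
  obtain ⟨f, hf⟩ := exists_isometry_apply_eq (hx.trans hu.symm)
  refine ⟨f.toIsometryEquiv ⁻¹' (U ∩ sphere (0 : Euc n) 1), ?_, ?_⟩
  · refine mem_nhdsWithin.2 ⟨f ⁻¹' U, hU.preimage f.continuous, ?_, ?_⟩
    · simpa [hf] using huU
    · rintro y ⟨hy1, hy2⟩
      exact ⟨hy1, by simpa using hy2⟩
  · rw [IsometryEquiv.hausdorffMeasure_preimage, h0]

lemma meanWidth_pos (hn : 1 ≤ n) {K : ConvexBody (Euc n)} (hK : K ∈ nontrivialBodies n) :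
    0 < meanWidth K := by
  obtain ⟨a, ha, b, hb, hab⟩ := hK
  -- The support function may change sign, but the width `w` is nonnegative and has twice its
  -- integral; it is positive in the direction `a - b`.
  set w : Euc n → ℝ := fun ν => supportFun K ν + supportFun K (-ν)
  have hwc : Continuous w := (continuous_supportFun K).add
    ((continuous_supportFun K).comp continuous_neg)
  have hw0 : ∀ ν, 0 ≤ w ν := fun ν => by linarith [neg_supportFun_neg_le K ν]
  have hint : ∫ ν in sphere (0 : Euc n) 1, w ν ∂μH[(n : ℝ) - 1]
      = 2 * ∫ ν in sphere (0 : Euc n) 1, supportFun K ν ∂μH[(n : ℝ) - 1] := by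
    have := setIntegral_sphere_comp (LinearIsometryEquiv.neg ℝ) (supportFun K)
    simp only [LinearIsometryEquiv.coe_neg] at this
    have h2 := integral_add (integrableOn_sphere hn (continuous_supportFun K))
      (integrableOn_sphere hn ((continuous_supportFun K).comp continuous_neg))
    simp only [Function.comp_apply] at h2
    rw [h2, this]
    ring
  have hd : 0 < ‖a - b‖ := norm_pos_iff.2 (sub_ne_zero.2 hab)
  set u : Euc n := ‖a - b‖⁻¹ • (a - b)
  have hu : ‖u‖ = 1 := by rw [norm_smul, norm_inv, norm_norm, inv_mul_cancel₀ hd.ne']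
  have hwu : 0 < w u := by
    have h1 := inner_le_supportFun ha u
    have h2 := inner_le_supportFun hb (-u)
    rw [inner_neg_right] at h2
    have h3 : inner ℝ a u - inner ℝ b u = ‖a - b‖ := by
      rw [← inner_sub_left, real_inner_smul_right, real_inner_self_eq_norm_sq]
      field_simp
    simp only [w]
    linarith
  have hpos : 0 < ∫ ν in sphere (0 : Euc n) 1, w ν ∂μH[(n : ℝ) - 1] := by
    rw [setIntegral_pos_iff_support_of_nonneg_ae (Filter.Eventually.of_forall hw0)
      (integrableOn_sphere hn hwc)]
    refine measure_inter_sphere_pos hn (isOpen_ne_fun hwc continuous_const) hu ?_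
    exact hwu.ne'
  have hA := ENNReal.toReal_pos (sphere_measure_pos hn).ne' (sphere_measure_ne_top hn)
  unfold meanWidth
  refine mul_pos (by positivity) ?_
  linarith

end ConvexShape

/-! ### Averages over rotations and convergence to balls. -/

namespace ConvexShape

variable {n : ℕ}

open MeasureTheory Metric Set Module Filter

/-- The reflection exchanging `u` and `v` has determinant `-1`; a second reflection fixing `v`,
available in dimension at least two, corrects the sign. -/
lemma exists_rotation_apply_eq (hn : 2 ≤ n) {u v : Euc n} (h : ‖u‖ = ‖v‖) :
    ∃ f : Euc n ≃ₗᵢ[ℝ] Euc n,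
      LinearMap.det (f.toLinearEquiv : Euc n →ₗ[ℝ] Euc n) = 1 ∧ f u = v := by
  have hdet : ∀ w : Euc n, w ≠ 0 → LinearMap.det
      ((Submodule.reflection (Submodule.span ℝ {w})ᗮ).toLinearEquiv : Euc n →ₗ[ℝ] Euc n) = -1 := by
    intro w hw
    have := Submodule.det_reflection (Submodule.span ℝ {w})ᗮ
    rw [Submodule.orthogonal_orthogonal, finrank_span_singleton hw, pow_one] at this
    exact this
  by_cases huv : u = v
  · exact ⟨LinearIsometryEquiv.refl ℝ _, LinearMap.det_id, huv⟩
  obtain ⟨w, hw, hw0⟩ : ∃ w ∈ (Submodule.span ℝ {v})ᗮ, w ≠ 0 := by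
    refine Submodule.exists_mem_ne_zero_of_ne_bot fun hbot => ?_
    have h1 := (Submodule.span ℝ {v}).finrank_add_finrank_orthogonal
    rw [hbot, finrank_bot, finrank_euclideanSpace_fin] at h1
    have := finrank_span_le_card (R := ℝ) ({v} : Set (Euc n))
    rw [toFinset_singleton, Finset.card_singleton] at this
    omega
  refine ⟨(Submodule.reflection (Submodule.span ℝ {u - v})ᗮ).trans
    (Submodule.reflection (Submodule.span ℝ {w})ᗮ), ?_, ?_⟩
  · have h1 := hdet _ (sub_ne_zero.2 huv)
    have h2 := hdet w hw0
    have h3 := LinearMap.det_comp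
      ((Submodule.reflection (Submodule.span ℝ {w})ᗮ).toLinearEquiv : Euc n →ₗ[ℝ] Euc n)
      ((Submodule.reflection (Submodule.span ℝ {u - v})ᗮ).toLinearEquiv : Euc n →ₗ[ℝ] Euc n)
    rw [h1, h2] at h3
    norm_num at h3
    exact h3
  · rw [LinearIsometryEquiv.trans_apply, Submodule.reflection_sub h]
    refine Submodule.reflection_mem_subspace_eq_self ?_
    rw [Submodule.mem_orthogonal_singleton_iff_inner_left]
    exact Submodule.mem_orthogonal_singleton_iff_inner_right.1 hw

/-- Finitely many rotations that almost act transitively on the unit sphere. -/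
lemma exists_finset_rotations (hn : 2 ≤ n) {δ : ℝ} (hδ : 0 < δ) :
    ∃ s : Finset (Euc n ≃ₗᵢ[ℝ] Euc n), s.Nonempty ∧
      (∀ f ∈ s, LinearMap.det (f.toLinearEquiv : Euc n →ₗ[ℝ] Euc n) = 1) ∧
      ∀ ν μ : Euc n, ‖ν‖ = 1 → ‖μ‖ = 1 → ∃ f ∈ s, ‖f.symm ν - μ‖ ≤ δ := by
  classical
  obtain ⟨t, hts, htf, hcov⟩ := (isCompact_sphere (0 : Euc n) 1).finite_cover_balls (half_pos hδ)
  have hex : ∀ a b : Euc n, ∃ f : Euc n ≃ₗᵢ[ℝ] Euc n,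
      LinearMap.det (f.toLinearEquiv : Euc n →ₗ[ℝ] Euc n) = 1 ∧ (‖a‖ = ‖b‖ → f a = b) := by
    intro a b
    by_cases h : ‖a‖ = ‖b‖
    · obtain ⟨f, h1, h2⟩ := exists_rotation_apply_eq hn h
      exact ⟨f, h1, fun _ => h2⟩
    · exact ⟨LinearIsometryEquiv.refl ℝ _, LinearMap.det_id, fun h' => absurd h' h⟩
  choose ρ hρ1 hρ2 using hex
  have hnet : ∀ ν : Euc n, ‖ν‖ = 1 → ∃ p ∈ t, ‖p‖ = 1 ∧ ‖ν - p‖ ≤ δ / 2 := by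
    intro ν hν
    obtain ⟨p, hp, hp'⟩ := mem_iUnion₂.1 (hcov (mem_sphere_zero_iff_norm.2 hν))
    refine ⟨p, hp, mem_sphere_zero_iff_norm.1 (hts hp), ?_⟩
    rw [← dist_eq_norm]
    exact (mem_ball.1 hp').le
  have hcov2 : ∀ ν μ : Euc n, ‖ν‖ = 1 → ‖μ‖ = 1 →
      ∃ f ∈ (htf.toFinset ×ˢ htf.toFinset).image (fun q => ρ q.1 q.2), ‖f.symm ν - μ‖ ≤ δ := by
    intro ν μ hν hμ
    obtain ⟨p, hp, hp1, hp2⟩ := hnet μ hμ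
    obtain ⟨q, hq, hq1, hq2⟩ := hnet ν hν
    -- The finite family consists of rotations between all pairs of points of a `δ / 2`-net; the
    -- errors at the two ends add up to `δ`.
    refine ⟨ρ p q, Finset.mem_image.2 ⟨(p, q), by simp [hp, hq], rfl⟩, ?_⟩
    have hpq := hρ2 p q (hp1.trans hq1.symm)
    have h1 : ‖(ρ p q).symm ν - μ‖ = ‖ν - ρ p q μ‖ := by
      rw [← (ρ p q).norm_map, map_sub, LinearIsometryEquiv.apply_symm_apply]
    have h2 : ν - ρ p q μ = (ν - q) - ρ p q (μ - p) := by
      rw [map_sub, hpq]; abel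
    rw [h1, h2]
    refine (norm_sub_le _ _).trans ?_
    rw [LinearIsometryEquiv.norm_map]
    linarith
  refine ⟨_, ?_, ?_, hcov2⟩
  · have : Nontrivial (Euc n) := by
      refine Module.nontrivial_of_finrank_pos (R := ℝ) ?_
      rw [finrank_euclideanSpace_fin]; omega
    obtain ⟨v, hv⟩ := exists_norm_eq (Euc n) zero_le_one
    obtain ⟨f, hf, -⟩ := hcov2 v v hv hv
    exact ⟨f, hf⟩
  · intro f hf
    obtain ⟨q, -, rfl⟩ := Finset.mem_image.1 hf
    exact hρ1 _ _

/-- The Minkowski average of the images of a body under finitely many isometries. -/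
noncomputable def isometryAverage (s : Finset (Euc n ≃ₗᵢ[ℝ] Euc n)) (K : ConvexBody (Euc n)) :
    ConvexBody (Euc n) :=
  (s.card : ℝ)⁻¹ • ∑ f ∈ s, rotate f K

lemma supportFun_isometryAverage (s : Finset (Euc n ≃ₗᵢ[ℝ] Euc n)) (K : ConvexBody (Euc n))
    (ν : Euc n) :
    supportFun (isometryAverage s K) ν = (s.card : ℝ)⁻¹ * ∑ f ∈ s, supportFun K (f.symm ν) := by
  unfold isometryAverage
  rw [supportFun_smul (by positivity), supportFun_sum]
  simp only [supportFun_rotate]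

lemma meanWidth_isometryAverage (hn : 1 ≤ n) {s : Finset (Euc n ≃ₗᵢ[ℝ] Euc n)} (hs : s.Nonempty)
    (K : ConvexBody (Euc n)) : meanWidth (isometryAverage s K) = meanWidth K := by
  unfold isometryAverage
  rw [meanWidth_smul (by positivity), meanWidth_sum hn]
  simp only [meanWidth_rotate, Finset.sum_const, nsmul_eq_mul]
  have : (s.card : ℝ) ≠ 0 := by exact_mod_cast hs.card_pos.ne'
  field_simp

lemma supportFun_isometryAverage_le {s : Finset (Euc n ≃ₗᵢ[ℝ] Euc n)} (hs : s.Nonempty)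
    {K : ConvexBody (Euc n)} {R : ℝ} (h : ∀ ν : Euc n, ‖ν‖ = 1 → supportFun K ν ≤ R)
    {ν : Euc n} (hν : ‖ν‖ = 1) : supportFun (isometryAverage s K) ν ≤ R := by
  rw [supportFun_isometryAverage, inv_mul_le_iff₀ (by exact_mod_cast hs.card_pos)]
  have h1 := Finset.sum_le_card_nsmul s (fun f => supportFun K (f.symm ν)) R
    (fun f _ => h _ (by rw [LinearIsometryEquiv.norm_map, hν]))
  rwa [nsmul_eq_mul] at h1

lemma le_supportFun_isometryAverage {s : Finset (Euc n ≃ₗᵢ[ℝ] Euc n)} (hs : s.Nonempty)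
    {K : ConvexBody (Euc n)} {R : ℝ} (h : ∀ ν : Euc n, ‖ν‖ = 1 → R ≤ supportFun K ν)
    {ν : Euc n} (hν : ‖ν‖ = 1) : R ≤ supportFun (isometryAverage s K) ν := by
  rw [supportFun_isometryAverage, le_inv_mul_iff₀ (by exact_mod_cast hs.card_pos)]
  have h1 := Finset.card_nsmul_le_sum s (fun f => supportFun K (f.symm ν)) R
    (fun f _ => h _ (by rw [LinearIsometryEquiv.norm_map, hν]))
  rwa [nsmul_eq_mul] at h1

lemma norm_le_of_supportFun_le {K : ConvexBody (Euc n)} {R : ℝ} (hR : 0 ≤ R)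
    (h : ∀ ν : Euc n, ‖ν‖ = 1 → supportFun K ν ≤ R) : ∀ x ∈ K, ‖x‖ ≤ R := by
  intro x hx
  have : x ∈ ((ballBody (0 : Euc n) hR : ConvexBody (Euc n)) : Set (Euc n)) := by
    refine subset_of_supportFun_le (fun ν hν => ?_) hx
    rw [supportFun_ballBody _ _ hν, inner_zero_left, add_zero]
    exact h ν hν
  exact mem_closedBall_zero_iff.1 this

lemma supportFun_le_of_norm_le {K : ConvexBody (Euc n)} {R : ℝ} (h : ∀ x ∈ K, ‖x‖ ≤ R)
    {ν : Euc n} (hν : ‖ν‖ = 1) : supportFun K ν ≤ R := by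
  refine supportFun_le fun x hx => (real_inner_le_norm x ν).trans ?_
  rw [hν, mul_one]
  exact h x hx

/-- Averaging over sufficiently many rotations contracts the oscillation of the support function. -/
lemma isometryAverage_oscillation {s : Finset (Euc n ≃ₗᵢ[ℝ] Euc n)} (hs : s.Nonempty) {δ R c : ℝ}
    (hR : 0 ≤ R)
    (hcov : ∀ ν μ : Euc n, ‖ν‖ = 1 → ‖μ‖ = 1 → ∃ f ∈ s, ‖f.symm ν - μ‖ ≤ δ)
    {L : ConvexBody (Euc n)} (hL : ∀ ν : Euc n, ‖ν‖ = 1 → supportFun L ν ≤ R)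
    (hosc : ∀ ν μ : Euc n, ‖ν‖ = 1 → ‖μ‖ = 1 → supportFun L ν - supportFun L μ ≤ c)
    {ν μ : Euc n} (hν : ‖ν‖ = 1) (hμ : ‖μ‖ = 1) :
    supportFun (isometryAverage s L) ν - supportFun (isometryAverage s L) μ
      ≤ c - (c - R * δ) / s.card := by
  classical
  have hne : (sphere (0 : Euc n) 1).Nonempty := ⟨ν, mem_sphere_zero_iff_norm.2 hν⟩
  obtain ⟨a, ha, hmax⟩ := (isCompact_sphere (0 : Euc n) 1).exists_isMaxOn hne
    (continuous_supportFun L).continuousOn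
  obtain ⟨b, hb, hmin⟩ := (isCompact_sphere (0 : Euc n) 1).exists_isMinOn hne
    (continuous_supportFun L).continuousOn
  rw [mem_sphere_zero_iff_norm] at ha hb
  have hmax' : ∀ ξ : Euc n, ‖ξ‖ = 1 → supportFun L ξ ≤ supportFun L a :=
    fun ξ hξ => hmax (mem_sphere_zero_iff_norm.2 hξ)
  have hmin' : ∀ ξ : Euc n, ‖ξ‖ = 1 → supportFun L b ≤ supportFun L ξ :=
    fun ξ hξ => hmin (mem_sphere_zero_iff_norm.2 hξ)
  have hlow := le_supportFun_isometryAverage hs hmin' hμ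
  -- One rotation sends `ν` close to a minimum point `b`. Its term is at most the minimum plus `R *
  -- δ`, the others at most the maximum, and this is the gain over `c`.
  obtain ⟨f0, hf0, hclose⟩ := hcov ν b hν hb
  have h0 : supportFun L (f0.symm ν) ≤ supportFun L b + R * δ := by
    have h1 := supportFun_sub_le (norm_le_of_supportFun_le hR hL) (f0.symm ν) b
    have h2 := mul_le_mul_of_nonneg_left hclose hR
    linarith
  have hN : (0 : ℝ) < s.card := by exact_mod_cast hs.card_pos
  have hN1 : (1 : ℝ) ≤ s.card := by exact_mod_cast hs.card_pos
  have hup : supportFun (isometryAverage s L) ν * s.card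
      ≤ (s.card - 1) * supportFun L a + (supportFun L b + R * δ) := by
    rw [supportFun_isometryAverage, mul_comm, mul_inv_cancel_left₀ hN.ne',
      ← Finset.sum_erase_add s _ hf0]
    have h1 := Finset.sum_le_card_nsmul (s.erase f0) (fun f => supportFun L (f.symm ν))
      (supportFun L a) (fun f _ => hmax' _ (by rw [LinearIsometryEquiv.norm_map, hν]))
    rw [nsmul_eq_mul, Finset.card_erase_of_mem hf0, Nat.cast_sub hs.card_pos, Nat.cast_one] at h1
    linarith
  have hc := hosc a b ha hb
  have h3 : (supportFun (isometryAverage s L) ν - supportFun (isometryAverage s L) μ) * s.card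
      ≤ c * s.card - (c - R * δ) := by
    nlinarith
  rw [← sub_nonneg]
  have h4 : 0 ≤ (c * s.card - (c - R * δ) -
    (supportFun (isometryAverage s L) ν - supportFun (isometryAverage s L) μ) * s.card)
      / s.card := div_nonneg (by linarith) hN.le
  convert h4 using 1
  field_simp

/-- A class of convex bodies of bounded size that is stable under averages of rotations contains
bodies that are arbitrarily close to a ball centred at the origin. -/
lemma exists_oscillation_le (hn : 2 ≤ n) {Q : ConvexBody (Euc n) → Prop} {R : ℝ} (hR : 0 ≤ R)
    (hQR : ∀ L, Q L → ∀ ν : Euc n, ‖ν‖ = 1 → supportFun L ν ≤ R)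
    (hQ : ∀ L, Q L → ∀ s : Finset (Euc n ≃ₗᵢ[ℝ] Euc n), s.Nonempty →
      (∀ f ∈ s, LinearMap.det (f.toLinearEquiv : Euc n →ₗ[ℝ] Euc n) = 1) →
        Q (isometryAverage s L))
    {K : ConvexBody (Euc n)} (hK : Q K) {ε : ℝ} (hε : 0 < ε) :
    ∃ L, Q L ∧ ∀ ν μ : Euc n, ‖ν‖ = 1 → ‖μ‖ = 1 → supportFun L ν - supportFun L μ ≤ ε := by
  -- `A` collects the oscillation bounds attained in the class. Its infimum must be zero, since
  -- otherwise one further averaging would go below it.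
  set A : Set ℝ := {c | 0 ≤ c ∧ ∃ L, Q L ∧
    ∀ ν μ : Euc n, ‖ν‖ = 1 → ‖μ‖ = 1 → supportFun L ν - supportFun L μ ≤ c}
  have hAne : A.Nonempty := by
    refine ⟨R + R, by positivity, K, hK, fun ν μ hν hμ => ?_⟩
    have h1 := hQR K hK ν hν
    have h2 := hQR K hK (-μ) (by rwa [norm_neg])
    have h3 := neg_supportFun_neg_le K μ
    linarith
  have hAb : BddBelow A := ⟨0, fun c hc => hc.1⟩
  by_contra! hcon
  have hlb : ε ≤ sInf A := by
    refine le_csInf hAne fun c hc => ?_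
    by_contra! hlt
    obtain ⟨-, L, hL, h⟩ := hc
    obtain ⟨ν, μ, hν, hμ, h'⟩ := hcon L hL
    linarith [h ν μ hν hμ]
  set c₀ := sInf A
  have hc₀ : 0 < c₀ := hε.trans_le hlb
  -- This `δ` gives `R * δ ≤ c₀ / 2`, so averaging lowers any bound `c ≥ c₀` by at least `c₀ / (2 *
  -- s.card)`; the denominator `R + 1` covers `R = 0`.
  obtain ⟨s, hs, hs1, hcov⟩ := exists_finset_rotations (δ := c₀ / (2 * (R + 1))) hn (by positivity)
  have hN : (0 : ℝ) < s.card := by exact_mod_cast hs.card_pos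
  have hRδ : R * (c₀ / (2 * (R + 1))) ≤ c₀ / 2 := by
    rw [mul_div_assoc', div_le_div_iff₀ (by positivity) (by positivity)]
    nlinarith
  obtain ⟨c, hcA, hc⟩ := exists_lt_of_csInf_lt hAne
    (show sInf A < c₀ + c₀ / (2 * s.card) from lt_add_of_pos_right _ (by positivity))
  have hcc : c₀ ≤ c := csInf_le hAb hcA
  obtain ⟨hc0, L, hL, hosc⟩ := hcA
  have hlt : c - (c - R * (c₀ / (2 * (R + 1)))) / s.card < c₀ := by
    have h1 : c₀ / (2 * s.card) ≤ (c - R * (c₀ / (2 * (R + 1)))) / s.card := by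
      rw [← div_div]
      gcongr
      linarith
    linarith
  have hosc' := fun ν μ (hν : ‖ν‖ = 1) (hμ : ‖μ‖ = 1) =>
    isometryAverage_oscillation hs hR hcov (hQR L hL) hosc hν hμ
  refine absurd (csInf_le hAb (show max 0 (c - (c - R * (c₀ / (2 * (R + 1)))) / s.card) ∈ A from
    ⟨le_max_left _ _, _, hQ L hL s hs hs1, fun ν μ hν hμ =>
      (hosc' ν μ hν hμ).trans (le_max_right _ _)⟩)) (not_le.2 (max_lt hc₀ hlt))

/-- Half the mean width is the average of the support function, so small oscillation means closeness
to the constant `m`. -/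
lemma exists_abs_supportFun_sub_le (hn : 2 ≤ n) {Q : ConvexBody (Euc n) → Prop} {R m : ℝ}
    (hR : 0 ≤ R)
    (hQR : ∀ L, Q L → ∀ ν : Euc n, ‖ν‖ = 1 → supportFun L ν ≤ R)
    (hQm : ∀ L, Q L → meanWidth L = 2 * m)
    (hQ : ∀ L, Q L → ∀ s : Finset (Euc n ≃ₗᵢ[ℝ] Euc n), s.Nonempty →
      (∀ f ∈ s, LinearMap.det (f.toLinearEquiv : Euc n →ₗ[ℝ] Euc n) = 1) →
        Q (isometryAverage s L))
    {K : ConvexBody (Euc n)} (hK : Q K) {ε : ℝ} (hε : 0 < ε) :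
    ∃ L, Q L ∧ ∀ ν : Euc n, ‖ν‖ = 1 → |supportFun L ν - m| ≤ ε := by
  obtain ⟨L, hL, h⟩ := exists_oscillation_le hn hR hQR hQ hK hε
  refine ⟨L, hL, fun ν hν => abs_le.2 ⟨?_, ?_⟩⟩
  · have := meanWidth_le (K := L) (c := supportFun L ν + ε) (by omega)
      fun μ hμ => by linarith [h μ ν hμ hν]
    rw [hQm L hL] at this
    linarith
  · have := le_meanWidth (K := L) (c := supportFun L ν - ε) (by omega)
      fun μ hμ => by linarith [h ν μ hν hμ]
    rw [hQm L hL] at this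
    linarith

/-! ### Superadditive functionals. -/

/-- A functional `G` that is `1`-homogeneous, invariant under rigid motions and superadditive with
respect to Minkowski addition. -/
structure IsConcaveShape (G : ConvexBody (Euc n) → ℝ≥0∞) : Prop where
  smul : ∀ (K : ConvexBody (Euc n)) (t : ℝ), 0 < t → G (t • K) = ENNReal.ofReal t * G K
  rigid : IsRigidMotionInvariant G
  add_le : ∀ K L : ConvexBody (Euc n), G K + G L ≤ G (K + L)

namespace IsConcaveShape

variable {G : ConvexBody (Euc n) → ℝ≥0∞}

lemma translate_eq (hG : IsConcaveShape G) (K : ConvexBody (Euc n)) (x : Euc n) :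
    G (translate K x) = G K :=
  hG.rigid (LinearIsometryEquiv.refl ℝ _) x K _ LinearMap.det_id rfl

lemma rotate_eq (hG : IsConcaveShape G) (K : ConvexBody (Euc n)) {f : Euc n ≃ₗᵢ[ℝ] Euc n}
    (hf : LinearMap.det (f.toLinearEquiv : Euc n →ₗ[ℝ] Euc n) = 1) :
    G (rotate f K) = G K :=
  hG.rigid f 0 K _ hf (by simp [rotate])

lemma sum_le (hG : IsConcaveShape G) {ι : Type*} (s : Finset ι) (K : ι → ConvexBody (Euc n)) :
    ∑ i ∈ s, G (K i) ≤ G (∑ i ∈ s, K i) := by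
  classical
  induction s using Finset.induction_on with
  | empty => simp
  | insert i s hi ih =>
    rw [Finset.sum_insert hi, Finset.sum_insert hi]
    exact (add_le_add le_rfl ih).trans (hG.add_le _ _)

/-- Superadditivity gives `s.card` equal terms, and homogeneity cancels the factor. -/
lemma le_isometryAverage (hG : IsConcaveShape G) {s : Finset (Euc n ≃ₗᵢ[ℝ] Euc n)}
    (hs : s.Nonempty)
    (hs1 : ∀ f ∈ s, LinearMap.det (f.toLinearEquiv : Euc n →ₗ[ℝ] Euc n) = 1)
    (K : ConvexBody (Euc n)) : G K ≤ G (isometryAverage s K) := by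
  have hN : (0 : ℝ) < s.card := by exact_mod_cast hs.card_pos
  unfold isometryAverage
  rw [hG.smul _ _ (inv_pos.2 hN)]
  refine le_trans ?_ (mul_le_mul_right (hG.sum_le s _) _)
  rw [Finset.sum_congr rfl fun f hf => hG.rotate_eq K (hs1 f hf), Finset.sum_const, nsmul_eq_mul,
    ← mul_assoc, ENNReal.ofReal_inv_of_pos hN, ENNReal.ofReal_natCast,
    ENNReal.inv_mul_cancel (by exact_mod_cast hs.card_pos.ne') (ENNReal.natCast_ne_top _), one_mul]

/-- Among bodies of given mean width, balls have the largest value. -/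
lemma le_ballBody (hG : IsConcaveShape G) (hcont : Continuous G) (hn : 2 ≤ n)
    {K : ConvexBody (Euc n)} {m : ℝ} (hm : 0 ≤ m) (hK : meanWidth K = 2 * m) :
    G K ≤ G (ballBody 0 hm) := by
  obtain ⟨R, hR, hKR⟩ := exists_norm_le K
  have hex : ∀ j : ℕ, ∃ L, (meanWidth L = 2 * m ∧ (∀ ν : Euc n, ‖ν‖ = 1 → supportFun L ν ≤ R) ∧
      G K ≤ G L) ∧ ∀ ν : Euc n, ‖ν‖ = 1 → |supportFun L ν - m| ≤ 1 / ((j : ℝ) + 1) := by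
    intro j
    -- The class consists of bodies with the mean width of `K`, support function at most `R` and
    -- `G`-value at least `G K`; averaging preserves all three.
    refine exists_abs_supportFun_sub_le (K := K) hn hR (fun L hL => hL.2.1) (fun L hL => hL.1) ?_
      ⟨hK, fun ν hν => supportFun_le_of_norm_le hKR hν, le_rfl⟩ (by positivity)
    rintro L ⟨h1, h2, h3⟩ s hs hs1
    exact ⟨by rw [meanWidth_isometryAverage (by omega) hs, h1],
      fun ν hν => supportFun_isometryAverage_le hs h2 hν, h3.trans (hG.le_isometryAverage hs hs1 L)⟩
  choose L hL hclose using hex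
  have hlim : Tendsto L atTop (nhds (ballBody 0 hm)) := by
    rw [tendsto_iff_dist_tendsto_zero]
    refine squeeze_zero (fun _ => dist_nonneg) (fun j => ?_) tendsto_one_div_add_atTop_nhds_zero_nat
    refine dist_le_of_supportFun (by positivity) fun ν hν => ?_
    rw [supportFun_ballBody _ _ hν, inner_zero_left, add_zero]
    exact hclose j ν hν
  exact ge_of_tendsto ((hcont.tendsto _).comp hlim) (Eventually.of_forall fun j => (hL j).2.2)

end IsConcaveShape

/-! ### Recognizing balls and translates. -/

lemma smul_ballBody {r : ℝ} (hr : 0 ≤ r) :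
    r • ballBody (0 : Euc n) zero_le_one = ballBody 0 hr := by
  refine eq_of_supportFun_eq fun ν hν => ?_
  rw [supportFun_smul hr, supportFun_ballBody _ _ hν, supportFun_ballBody _ _ hν, inner_zero_left]
  ring

lemma eq_translate_ballBody {B : ConvexBody (Euc n)} {x : Euc n} {r : ℝ} (hr : 0 ≤ r)
    (hB : (B : Set (Euc n)) = closedBall x r) : B = translate (ballBody 0 hr) x := by
  refine eq_of_supportFun_eq fun ν hν => ?_
  rw [supportFun_of_closedBall hr hB hν, supportFun_translate, supportFun_ballBody _ _ hν,
    inner_zero_left, add_zero]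

lemma eq_or_eq_neg_of_finrank_one {u ν : Euc 1} (hu : ‖u‖ = 1) (hν : ‖ν‖ = 1) :
    ν = u ∨ ν = -u := by
  rw [EuclideanSpace.norm_eq, Fin.sum_univ_one, Real.sqrt_sq_eq_abs, Real.norm_eq_abs,
    abs_abs] at hu hν
  rcases abs_eq_abs.1 (hν.trans hu.symm) with h | h
  · exact Or.inl (by ext i; rw [Subsingleton.elim i 0]; exact h)
  · exact Or.inr (by ext i; rw [Subsingleton.elim i 0]; exact h)

/-- On the line, every convex body with more than one point is a ball. -/
lemma isBall_of_dim_one {K : ConvexBody (Euc 1)} (hK : K ∈ nontrivialBodies 1) : IsBall K := by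
  obtain ⟨u, hu⟩ := exists_norm_eq (Euc 1) zero_le_one
  set r := (supportFun K u + supportFun K (-u)) / 2 with hr
  set c := (supportFun K u - supportFun K (-u)) / 2 with hc
  have hr0 : 0 ≤ r := by linarith [neg_supportFun_neg_le K u]
  have huu : inner ℝ u u = (1 : ℝ) := by rw [real_inner_self_eq_norm_sq, hu]; norm_num
  have heq : K = ballBody (c • u) hr0 := by
    refine eq_of_supportFun_eq fun ν hν => ?_
    rw [supportFun_ballBody _ _ hν]
    rcases eq_or_eq_neg_of_finrank_one hu hν with rfl | rfl
    · rw [real_inner_smul_left, huu, hr, hc]; ring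
    · rw [inner_neg_right, real_inner_smul_left, huu, hr, hc]; ring
  have hM := meanWidth_pos le_rfl hK
  rw [meanWidth_of_closedBall le_rfl hr0 (show (K : Set (Euc 1)) = closedBall (c • u) r by
    conv_lhs => rw [heq]
    rfl)] at hM
  exact ⟨c • u, r, by linarith, by conv_lhs => rw [heq]
                                   rfl⟩

lemma IsBall.mem_nontrivialBodies (hn : 1 ≤ n) {B : ConvexBody (Euc n)} (hB : IsBall B) :
    B ∈ nontrivialBodies n := by
  obtain ⟨x, r, hr, h⟩ := hB
  have : Nontrivial (Euc n) := by
    refine Module.nontrivial_of_finrank_pos (R := ℝ) ?_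
    rw [finrank_euclideanSpace_fin]; omega
  obtain ⟨v, hv⟩ := exists_norm_eq (Euc n) hr.le
  refine ⟨x, h ▸ mem_closedBall_self hr.le, x + v, h ▸ ?_, ?_⟩
  · simp [hv]
  · intro h
    have : v = 0 := by simpa using h.symm
    rw [this, norm_zero] at hv
    linarith

lemma meanWidth_eq_zero (hn : 1 ≤ n) {K : ConvexBody (Euc n)} (hK : K ∉ nontrivialBodies n) :
    meanWidth K = 0 := by
  obtain ⟨x, hx⟩ := K.nonempty
  have hs : (K : Set (Euc n)) = closedBall x 0 := by
    rw [closedBall_zero]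
    exact (not_nontrivial_iff.1 hK).eq_singleton_of_mem hx
  rw [meanWidth_of_closedBall hn le_rfl hs, mul_zero]

lemma mem_nontrivialBodies_iff (hn : 1 ≤ n) {K : ConvexBody (Euc n)} :
    K ∈ nontrivialBodies n ↔ 0 < meanWidth K :=
  ⟨meanWidth_pos hn, fun h => by_contra fun hK => h.ne' (meanWidth_eq_zero hn hK)⟩

lemma meanWidth_nonneg (hn : 1 ≤ n) (K : ConvexBody (Euc n)) : 0 ≤ meanWidth K := by
  by_cases hK : K ∈ nontrivialBodies n
  · exact (meanWidth_pos hn hK).le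
  · exact (meanWidth_eq_zero hn hK).ge

/-- The mean width scales by the ratio of the homothety, so equal positive widths force ratio one.
-/
lemma Homothetic.exists_translate (hn : 1 ≤ n) {K L : ConvexBody (Euc n)} (h : Homothetic K L)
    (hM : meanWidth L = meanWidth K) (hpos : 0 < meanWidth K) : ∃ x, L = translate K x := by
  have key : ∀ {K L : ConvexBody (Euc n)} {c : ℝ} {x : Euc n}, 0 ≤ c →
      meanWidth L = meanWidth K → 0 < meanWidth K →
      (L : Set (Euc n)) = (fun y => c • y + x) '' (K : Set (Euc n)) → L = translate K x := by
    intro K L c x hc hM hpos h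
    have h1 : L = translate (c • K) x := by
      refine eq_of_supportFun_eq fun ν _ => ?_
      rw [supportFun_of_homothety hc x h, supportFun_translate, supportFun_smul hc]
    have hc1 : c = 1 := by
      rw [h1, meanWidth_translate hn, meanWidth_smul hc] at hM
      exact mul_right_cancel₀ hpos.ne' (hM.trans (one_mul _).symm)
    rw [h1, hc1, one_smul]
  obtain ⟨c, x, hc, h | h⟩ := h
  · refine ⟨-x, ?_⟩
    have h1 := key hc hM.symm (hM ▸ hpos) h
    refine eq_of_supportFun_eq fun ν _ => ?_
    rw [h1, supportFun_translate, supportFun_translate, inner_neg_left, add_neg_cancel_right]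
  · exact ⟨x, key hc hM hpos h⟩

lemma translate_translate (K : ConvexBody (Euc n)) (x y : Euc n) :
    translate (translate K x) y = translate K (x + y) := by
  refine eq_of_supportFun_eq fun ν _ => ?_
  simp only [supportFun_translate, inner_add_left, add_assoc]

lemma isometryAverage_eq_translate {s : Finset (Euc n ≃ₗᵢ[ℝ] Euc n)} (hs : s.Nonempty)
    {K : ConvexBody (Euc n)} (h : ∀ f ∈ s, ∃ x, rotate f K = translate K x) :
    ∃ x, isometryAverage s K = translate K x := by
  choose! x hx using h
  have hN : (s.card : ℝ) ≠ 0 := by exact_mod_cast hs.card_pos.ne'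
  refine ⟨(s.card : ℝ)⁻¹ • ∑ f ∈ s, x f, eq_of_supportFun_eq fun ν _ => ?_⟩
  unfold isometryAverage
  rw [supportFun_smul (by positivity), supportFun_sum, Finset.sum_congr rfl fun f hf => by
    rw [hx f hf, supportFun_translate], Finset.sum_add_distrib, Finset.sum_const, nsmul_eq_mul,
    mul_add, inv_mul_cancel_left₀ hN, supportFun_translate, real_inner_smul_left, sum_inner]

/-- A body all of whose rotated copies, and those of its translates, are translates of it, is a
ball. -/
lemma isBall_of_rotate_eq_translate (hn : 2 ≤ n) {K : ConvexBody (Euc n)}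
    (hK : K ∈ nontrivialBodies n)
    (h : ∀ (y : Euc n) (f : Euc n ≃ₗᵢ[ℝ] Euc n),
      LinearMap.det (f.toLinearEquiv : Euc n →ₗ[ℝ] Euc n) = 1 →
        ∃ x, rotate f (translate K y) = translate (translate K y) x) : IsBall K := by
  obtain ⟨R, hR, hKR⟩ := exists_norm_le K
  obtain ⟨a, ha⟩ := K.nonempty
  set m := meanWidth K / 2 with hm
  have hm0 : 0 < m := half_pos (meanWidth_pos (by omega) hK)
  -- The class is now the translates of `K` with support function at most `R`; by hypothesis an
  -- average of rotated translates is again a translate. So some translates of `K` itself are almost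
  -- centred balls.
  have hex : ∀ j : ℕ, ∃ L, ((∀ ν : Euc n, ‖ν‖ = 1 → supportFun L ν ≤ R) ∧
      ∃ x, L = translate K x) ∧
      ∀ ν : Euc n, ‖ν‖ = 1 → |supportFun L ν - m| ≤ 1 / ((j : ℝ) + 1) := by
    intro j
    refine exists_abs_supportFun_sub_le (K := K) hn hR (fun L hL => hL.1) ?_ ?_
      ⟨fun ν hν => supportFun_le_of_norm_le hKR hν, 0, ?_⟩ (by positivity)
    · rintro L ⟨-, x, rfl⟩
      rw [meanWidth_translate (by omega), hm]; ring
    · rintro L ⟨h1, y, rfl⟩ s hs hs1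
      refine ⟨fun ν hν => supportFun_isometryAverage_le hs h1 hν, ?_⟩
      obtain ⟨x, hx⟩ := isometryAverage_eq_translate hs fun f hf => h y f (hs1 f hf)
      exact ⟨y + x, by rw [hx, translate_translate]⟩
    · refine eq_of_supportFun_eq fun ν _ => ?_
      rw [supportFun_translate, inner_zero_left, add_zero]
  choose L hL hclose using hex
  choose x hx using fun j => (hL j).2
  -- The translation vectors stay bounded, so a subsequence converges to some `z`, and `K`
  -- translated by `z` has constant support function `m`.
  have hxb : ∀ j, x j ∈ closedBall (0 : Euc n) (R + R) := by
    intro j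
    have h1 : a + x j ∈ L j := by
      rw [hx j]
      exact ⟨a, ha, rfl⟩
    have h2 := norm_le_of_supportFun_le hR (hL j).1 _ h1
    have h3 := norm_sub_le (a + x j) a
    rw [add_sub_cancel_left] at h3
    rw [mem_closedBall_zero_iff]
    linarith [hKR a ha]
  obtain ⟨z, -, φ, hφ, hz⟩ := (isCompact_closedBall (0 : Euc n) (R + R)).tendsto_subseq hxb
  have hsup : ∀ ν : Euc n, ‖ν‖ = 1 → supportFun K ν + inner ℝ z ν = m := by
    intro ν hν
    have h1 : Tendsto (fun j => supportFun K ν + inner ℝ (x (φ j)) ν) atTop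
        (nhds (supportFun K ν + inner ℝ z ν)) :=
      (((continuous_id.inner continuous_const).tendsto z).comp hz).const_add _
    have h2 : Tendsto (fun j => supportFun K ν + inner ℝ (x (φ j)) ν) atTop (nhds m) := by
      rw [tendsto_iff_dist_tendsto_zero]
      refine squeeze_zero (fun _ => dist_nonneg) (fun j => ?_)
        (tendsto_one_div_add_atTop_nhds_zero_nat.comp hφ.tendsto_atTop)
      have := hclose (φ j) ν hν
      rwa [hx, supportFun_translate] at this
    exact tendsto_nhds_unique h1 h2
  refine ⟨-z, m, hm0, ?_⟩
  have : K = ballBody (-z) hm0.le := by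
    refine eq_of_supportFun_eq fun ν hν => ?_
    rw [supportFun_ballBody _ _ hν, inner_neg_left, ← hsup ν hν]
    ring
  conv_lhs => rw [this]
  rfl

/-! ### Extremal bodies of the quotient. -/

lemma shapeQuotient_one (G : ConvexBody (Euc n) → ℝ≥0∞) (K : ConvexBody (Euc n)) :
    shapeQuotient 1 G K = G K / ENNReal.ofReal (meanWidth K) := by
  simp [shapeQuotient]

lemma shapeQuotient_mul (hn : 1 ≤ n) (G : ConvexBody (Euc n) → ℝ≥0∞) {K : ConvexBody (Euc n)}
    (hK : K ∈ nontrivialBodies n) :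
    shapeQuotient 1 G K * ENNReal.ofReal (meanWidth K) = G K := by
  rw [shapeQuotient_one]
  exact ENNReal.div_mul_cancel (ENNReal.ofReal_pos.2 (meanWidth_pos hn hK)).ne'
    ENNReal.ofReal_ne_top

lemma le_shapeQuotient_iff (hn : 1 ≤ n) (G : ConvexBody (Euc n) → ℝ≥0∞) {K : ConvexBody (Euc n)}
    (hK : K ∈ nontrivialBodies n) (c : ℝ≥0∞) :
    c ≤ shapeQuotient 1 G K ↔ c * ENNReal.ofReal (meanWidth K) ≤ G K := by
  rw [shapeQuotient_one]
  exact ENNReal.le_div_iff_mul_le (Or.inl (ENNReal.ofReal_pos.2 (meanWidth_pos hn hK)).ne')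
    (Or.inl ENNReal.ofReal_ne_top)

lemma shapeQuotient_le_iff (hn : 1 ≤ n) (G : ConvexBody (Euc n) → ℝ≥0∞) {K : ConvexBody (Euc n)}
    (hK : K ∈ nontrivialBodies n) (c : ℝ≥0∞) :
    shapeQuotient 1 G K ≤ c ↔ G K ≤ c * ENNReal.ofReal (meanWidth K) := by
  rw [shapeQuotient_one]
  exact ENNReal.div_le_iff (ENNReal.ofReal_pos.2 (meanWidth_pos hn hK)).ne' ENNReal.ofReal_ne_top

namespace IsConcaveShape

variable {G : ConvexBody (Euc n) → ℝ≥0∞}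

lemma shapeQuotient_isBall (hG : IsConcaveShape G) (hn : 1 ≤ n) {B : ConvexBody (Euc n)}
    (hB : IsBall B) :
    shapeQuotient 1 G B = shapeQuotient 1 G (ballBody 0 zero_le_one) := by
  obtain ⟨x, r, hr, h⟩ := hB
  have hMB := meanWidth_of_closedBall hn hr.le h
  have hM1 := meanWidth_of_closedBall hn zero_le_one
    (show ((ballBody (0 : Euc n) zero_le_one : ConvexBody (Euc n)) : Set (Euc n))
      = closedBall 0 1 from rfl)
  rw [shapeQuotient_one, shapeQuotient_one, hMB, hM1, eq_translate_ballBody hr.le h,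
    hG.translate_eq, ← smul_ballBody, hG.smul _ _ hr, mul_comm (2 : ℝ) r, mul_one,
    ENNReal.ofReal_mul hr.le, ENNReal.mul_div_mul_left _ _ (ENNReal.ofReal_pos.2 hr).ne'
      ENNReal.ofReal_ne_top]

/-- All balls share one quotient, so `L` may be compared with the ball of its own mean width.
Dimension one is separate because averaging over rotations needs `2 ≤ n`. -/
theorem isMaximizer_of_isBall (hG : IsConcaveShape G) (hcont : Continuous G) (hn : 1 ≤ n)
    {B : ConvexBody (Euc n)} (hB : IsBall B) : IsMaximizer 1 G B := by
  refine ⟨hB.mem_nontrivialBodies hn, fun L hL => ?_⟩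
  rcases hn.eq_or_lt with rfl | hn2
  · rw [hG.shapeQuotient_isBall le_rfl hB,
      hG.shapeQuotient_isBall le_rfl (isBall_of_dim_one hL)]
  · have hm : 0 < meanWidth L / 2 := half_pos (meanWidth_pos hn hL)
    have hb : IsBall (ballBody (0 : Euc n) hm.le) := ⟨0, _, hm, rfl⟩
    rw [hG.shapeQuotient_isBall hn hB, ← hG.shapeQuotient_isBall hn hb, shapeQuotient_one,
      shapeQuotient_one]
    have h2 : meanWidth L = 2 * (meanWidth L / 2) := by ring
    have h3 : meanWidth (ballBody (0 : Euc n) hm.le) = meanWidth L :=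
      (meanWidth_of_closedBall hn hm.le (x := 0) rfl).trans h2.symm
    rw [h3]
    exact ENNReal.div_le_div_right (hG.le_ballBody hcont hn2 hm.le h2) _

/-- For a translate `L` of a maximizer, `L + rotate f L` has twice its mean width; without homothety
it would have more than twice its `G`-value. -/
theorem isBall_of_isMaximizer (hG : IsConcaveShape G) (hn : 1 ≤ n)
    (hstrict : ∀ K L : ConvexBody (Euc n), ¬ Homothetic K L → G K + G L < G (K + L))
    {K : ConvexBody (Euc n)} (hK : IsMaximizer 1 G K) : IsBall K := by
  obtain ⟨hKn, hmax⟩ := hK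
  rcases hn.eq_or_lt with rfl | hn2
  · exact isBall_of_dim_one hKn
  refine isBall_of_rotate_eq_translate hn2 hKn fun y f hf => ?_
  set L := translate K y
  have hML : meanWidth L = meanWidth K := meanWidth_translate hn K y
  have hpos : 0 < meanWidth L := hML ▸ meanWidth_pos hn hKn
  refine Homothetic.exists_translate hn ?_ (meanWidth_rotate f L) hpos
  by_contra hh
  have h1 := hstrict _ _ hh
  have hMs : meanWidth (L + rotate f L) = 2 * meanWidth K := by
    rw [meanWidth_add hn, meanWidth_rotate, hML]; ring
  have hsn : L + rotate f L ∈ nontrivialBodies n := by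
    rw [mem_nontrivialBodies_iff hn, hMs, ← hML]; linarith
  have h2 := (shapeQuotient_le_iff hn G hsn _).1 (hmax _ hsn)
  rw [hMs, ENNReal.ofReal_mul zero_le_two, ENNReal.ofReal_ofNat, mul_left_comm,
    shapeQuotient_mul hn G hKn, two_mul] at h2
  rw [hG.rotate_eq L hf, hG.translate_eq] at h1
  exact absurd h2 (not_le.2 h1)

/-- A minimizer has only trivial decompositions as a Minkowski sum. -/
theorem homothetic_of_isMinimizer (hn : 1 ≤ n)
    (hstrict : ∀ K L : ConvexBody (Euc n), ¬ Homothetic K L → G K + G L < G (K + L))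
    {K L : ConvexBody (Euc n)} (h : IsMinimizer 1 G (K + L)) : Homothetic K L := by
  obtain ⟨hn0, hmin⟩ := h
  by_contra hh
  have h1 := hstrict _ _ hh
  -- Minimality, cleared of denominators, also holds for single points, where the left side is zero.
  -- Adding it for `K` and `L` contradicts strictness.
  have hle : ∀ A : ConvexBody (Euc n),
      shapeQuotient 1 G (K + L) * ENNReal.ofReal (meanWidth A) ≤ G A := by
    intro A
    by_cases hA : A ∈ nontrivialBodies n
    · exact (le_shapeQuotient_iff hn G hA _).1 (hmin A hA)
    · rw [meanWidth_eq_zero hn hA, ENNReal.ofReal_zero, mul_zero]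
      exact zero_le
  have h2 := add_le_add (hle K) (hle L)
  rw [← mul_add, ← ENNReal.ofReal_add (meanWidth_nonneg hn K) (meanWidth_nonneg hn L), ← meanWidth_add hn,
    shapeQuotient_mul hn G hn0] at h2
  exact absurd h2 (not_le.2 h1)

end IsConcaveShape

end ConvexShape

/-! ### Decomposing planar bodies by rescaling boundary arcs. -/

namespace ConvexShape

open Set Module

/-- The point of the unit circle with polar angle `θ`. -/
noncomputable def unitVec (θ : ℝ) : Euc 2 := !₂[Real.cos θ, Real.sin θ]

lemma inner_unitVec (x : Euc 2) (θ : ℝ) :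
    inner ℝ x (unitVec θ) = x 0 * Real.cos θ + x 1 * Real.sin θ := by
  simp [unitVec, PiLp.inner_apply, Fin.sum_univ_two]
  ring

lemma unitVec_add_two_pi (θ : ℝ) : unitVec (θ + 2 * Real.pi) = unitVec θ := by
  simp [unitVec]

lemma unitVec_sub_two_pi (θ : ℝ) : unitVec (θ - 2 * Real.pi) = unitVec θ := by
  simp [unitVec]

lemma exists_eq_unitVec (a : ℝ) {ν : Euc 2} (hν : ‖ν‖ = 1) :
    ∃ θ ∈ Ico a (a + 2 * Real.pi), ν = unitVec θ := by
  set z : ℂ := ⟨ν 0, ν 1⟩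
  have hz : ‖z‖ = 1 := by
    rw [← hν, EuclideanSpace.norm_eq, Fin.sum_univ_two, Complex.norm_def, Complex.normSq_mk]
    congr 1
    simp [sq]
  have hz0 : z ≠ 0 := norm_ne_zero_iff.1 (by rw [hz]; norm_num)
  have h1 : ν = unitVec z.arg := by
    ext i
    fin_cases i
    · simp [unitVec, Complex.cos_arg hz0, hz, z]
    · simp [unitVec, Complex.sin_arg, hz, z]
  refine ⟨toIcoMod Real.two_pi_pos a z.arg, toIcoMod_mem_Ico _ _ _, ?_⟩
  rw [h1, ← self_sub_toIcoDiv_zsmul]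
  have hper : Function.Periodic unitVec (2 * Real.pi) := unitVec_add_two_pi
  exact (hper.sub_zsmul_eq _).symm

/-- The linear relation between three plane directions; for angles in order within a half-turn its
coefficients are nonnegative. -/
lemma sin_mul_inner_unitVec (d : Euc 2) (s t φ : ℝ) :
    Real.sin (φ - s) * inner ℝ d (unitVec t)
      = Real.sin (φ - t) * inner ℝ d (unitVec s) + Real.sin (t - s) * inner ℝ d (unitVec φ) := by
  simp only [inner_unitVec, Real.sin_sub]
  ring

/-- A choice, for every direction `ν`, of a point of `K` that is extreme in this direction. -/
noncomputable def supportPoint (K : ConvexBody (Euc 2)) (θ : ℝ) : Euc 2 :=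
  (exists_supportFun_eq K (unitVec θ)).choose

lemma supportPoint_mem (K : ConvexBody (Euc 2)) (θ : ℝ) : supportPoint K θ ∈ K :=
  (exists_supportFun_eq K (unitVec θ)).choose_spec.1

lemma inner_supportPoint (K : ConvexBody (Euc 2)) (θ : ℝ) :
    inner ℝ (supportPoint K θ) (unitVec θ) = supportFun K (unitVec θ) :=
  (exists_supportFun_eq K (unitVec θ)).choose_spec.2.symm

lemma supportPoint_add_two_pi (K : ConvexBody (Euc 2)) (θ : ℝ) :
    supportPoint K (θ + 2 * Real.pi) = supportPoint K θ := by
  unfold supportPoint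
  simp only [unitVec_add_two_pi]

lemma inner_supportPoint_sub_nonneg (K : ConvexBody (Euc 2)) (s t : ℝ) :
    0 ≤ inner ℝ (supportPoint K t - supportPoint K s) (unitVec t) := by
  rw [inner_sub_left, inner_supportPoint, sub_nonneg]
  exact inner_le_supportFun (supportPoint_mem K s) _

/-- The chord from the extreme point at `s` to that at `t` is nonnegative against `unitVec t` and
nonpositive against `unitVec s`. A direction beyond `t`, up to a half-turn from `s`, is a positive
multiple of the first plus a nonpositive multiple of the second, or `t` itself when `t - s` is a
half-turn. -/
lemma inner_supportPoint_forward (K : ConvexBody (Euc 2)) {s t φ : ℝ} (hst : s ≤ t) (htφ : t ≤ φ)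
    (hφ : φ ≤ s + Real.pi) :
    0 ≤ inner ℝ (supportPoint K t - supportPoint K s) (unitVec φ) := by
  have h1 := inner_supportPoint_sub_nonneg K s t
  have h2 := inner_supportPoint_sub_nonneg K t s
  rw [← neg_sub, inner_neg_left] at h2
  have h := sin_mul_inner_unitVec (supportPoint K t - supportPoint K s) s t φ
  rcases hst.eq_or_lt with rfl | hst
  · simp
  rcases (show t - s ≤ Real.pi by linarith).eq_or_lt with hpi | hpi
  · rwa [show φ = t by linarith]
  have h3 : 0 < Real.sin (t - s) := Real.sin_pos_of_pos_of_lt_pi (by linarith) hpi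
  have h4 : 0 ≤ Real.sin (φ - s) := Real.sin_nonneg_of_nonneg_of_le_pi (by linarith) (by linarith)
  have h5 : 0 ≤ Real.sin (φ - t) := Real.sin_nonneg_of_nonneg_of_le_pi (by linarith) (by linarith)
  refine nonneg_of_mul_nonneg_right (a := Real.sin (t - s)) ?_ h3
  nlinarith [mul_nonneg h4 h1, mul_nonneg h5 h2]

lemma inner_supportPoint_backward (K : ConvexBody (Euc 2)) {s t φ : ℝ} (hφs : φ ≤ s) (hst : s ≤ t)
    (hφ : t ≤ φ + Real.pi) :
    inner ℝ (supportPoint K t - supportPoint K s) (unitVec φ) ≤ 0 := by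
  have h1 := inner_supportPoint_sub_nonneg K s t
  have h2 := inner_supportPoint_sub_nonneg K t s
  rw [← neg_sub, inner_neg_left] at h2
  have h := sin_mul_inner_unitVec (supportPoint K t - supportPoint K s) φ s t
  rcases hst.eq_or_lt with rfl | hst
  · simp
  rcases (show t - s ≤ Real.pi by linarith).eq_or_lt with hpi | hpi
  · rw [show φ = s by linarith]; linarith
  have h3 : 0 < Real.sin (t - s) := Real.sin_pos_of_pos_of_lt_pi (by linarith) hpi
  have h4 : 0 ≤ Real.sin (t - φ) := Real.sin_nonneg_of_nonneg_of_le_pi (by linarith) (by linarith)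
  have h5 : 0 ≤ Real.sin (s - φ) := Real.sin_nonneg_of_nonneg_of_le_pi (by linarith) (by linarith)
  refine nonpos_of_mul_nonpos_right (a := Real.sin (t - s)) ?_ h3
  nlinarith [mul_nonneg h4 h2, mul_nonneg h5 h1]

/-- The nearest-point retraction of the line onto `[a, b]`. -/
def clamp (a b θ : ℝ) : ℝ := max a (min θ b)

lemma clamp_of_mem {a b θ : ℝ} (h1 : a ≤ θ) (h2 : θ ≤ b) : clamp a b θ = θ := by
  unfold clamp; rw [min_eq_left h2, max_eq_right h1]

lemma clamp_of_le {a b θ : ℝ} (h1 : θ ≤ a) : clamp a b θ = a :=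
  max_eq_left ((min_le_left _ _).trans h1)

lemma clamp_of_ge {a b θ : ℝ} (hab : a ≤ b) (h1 : b ≤ θ) : clamp a b θ = b := by
  unfold clamp; rw [min_eq_right h1, max_eq_right hab]

/-- Either the arc `[a, b]` is not traversed between `s` and `t`, or the clamped parameters lie
within `[s, t]`; so chord inequalities pass to each arc of a scaled curve. -/
lemma clamp_eq_or {a b s t : ℝ} (hab : a ≤ b) (hst : s ≤ t) :
    clamp a b s = clamp a b t ∨
      (s ≤ clamp a b s ∧ clamp a b s ≤ clamp a b t ∧ clamp a b t ≤ t) := by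
  rcases le_or_gt t a with h1 | h1
  · left; rw [clamp_of_le h1, clamp_of_le (hst.trans h1)]
  rcases le_or_gt b s with h2 | h2
  · left; rw [clamp_of_ge hab h2, clamp_of_ge hab (h2.trans hst)]
  · right
    refine ⟨?_, max_le_max le_rfl (min_le_min hst le_rfl), max_le h1.le (min_le_left _ _)⟩
    exact (le_min le_rfl h2.le).trans (le_max_right _ _)

section Arcs

variable (K : ConvexBody (Euc 2)) (τ : Fin 5 → ℝ) (l : Fin 4 → ℝ)

/-- The boundary curve of `K`, with the arc between the directions `τ i` and `τ (i + 1)` scaled by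
the factor `l i`. -/
noncomputable def scaledCurve (θ : ℝ) : Euc 2 :=
  ∑ i : Fin 4, l i • supportPoint K (clamp (τ i.castSucc) (τ i.succ) θ)

variable {K τ l}

lemma arc_le (hτ : Monotone τ) (i : Fin 4) : τ i.castSucc ≤ τ i.succ :=
  hτ (Fin.castSucc_lt_succ).le

lemma inner_scaledCurve_forward (hτ : Monotone τ) (hl : ∀ i, 0 ≤ l i) {s t φ : ℝ} (hst : s ≤ t)
    (htφ : t ≤ φ) (hφ : φ ≤ s + Real.pi) :
    0 ≤ inner ℝ (scaledCurve K τ l t - scaledCurve K τ l s) (unitVec φ) := by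
  unfold scaledCurve
  rw [← Finset.sum_sub_distrib, sum_inner]
  refine Finset.sum_nonneg fun i _ => ?_
  rw [← smul_sub, real_inner_smul_left]
  refine mul_nonneg (hl i) ?_
  rcases clamp_eq_or (arc_le hτ i) hst with h | ⟨h1, h2, h3⟩
  · rw [h, sub_self, inner_zero_left]
  · exact inner_supportPoint_forward K h2 (h3.trans htφ) (by linarith)

lemma inner_scaledCurve_backward (hτ : Monotone τ) (hl : ∀ i, 0 ≤ l i) {s t φ : ℝ} (hφs : φ ≤ s)
    (hst : s ≤ t) (hφ : t ≤ φ + Real.pi) :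
    inner ℝ (scaledCurve K τ l t - scaledCurve K τ l s) (unitVec φ) ≤ 0 := by
  unfold scaledCurve
  rw [← Finset.sum_sub_distrib, sum_inner]
  refine Finset.sum_nonpos fun i _ => ?_
  rw [← smul_sub, real_inner_smul_left]
  refine mul_nonpos_of_nonneg_of_nonpos (hl i) ?_
  rcases clamp_eq_or (arc_le hτ i) hst with h | ⟨h1, h2, h3⟩
  · rw [h, sub_self, inner_zero_left]
  · exact inner_supportPoint_backward K (hφs.trans h1) h2 (by linarith)

lemma scaledCurve_last (hτ : Monotone τ)
    (hl : ∑ i : Fin 4, l i • (supportPoint K (τ i.succ) - supportPoint K (τ i.castSucc)) = 0) :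
    scaledCurve K τ l (τ (Fin.last 4)) = scaledCurve K τ l (τ 0) := by
  rw [← sub_eq_zero, ← hl]
  unfold scaledCurve
  rw [← Finset.sum_sub_distrib]
  refine Finset.sum_congr rfl fun i _ => ?_
  rw [← smul_sub, clamp_of_ge (arc_le hτ i) (hτ (Fin.le_last _)), clamp_of_le (hτ (Fin.zero_le _))]

/-- The support inequality for a closed scaled boundary curve. -/
lemma inner_scaledCurve_le (hτ : Monotone τ) (hper : τ (Fin.last 4) = τ 0 + 2 * Real.pi)
    (hl0 : ∀ i, 0 ≤ l i)
    (hl : ∑ i : Fin 4, l i • (supportPoint K (τ i.succ) - supportPoint K (τ i.castSucc)) = 0)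
    {θ φ : ℝ} (hθ : θ ∈ Icc (τ 0) (τ (Fin.last 4))) (hφ : φ ∈ Icc (τ 0) (τ (Fin.last 4))) :
    inner ℝ (scaledCurve K τ l θ) (unitVec φ) ≤ inner ℝ (scaledCurve K τ l φ) (unitVec φ) := by
  have hx := scaledCurve_last hτ hl
  obtain ⟨hθ1, hθ2⟩ := hθ
  obtain ⟨hφ1, hφ2⟩ := hφ
  have hπ := Real.pi_pos
  rcases le_total θ φ with h | h
  · rcases le_total φ (θ + Real.pi) with h' | h'
    · have := inner_scaledCurve_forward (K := K) hτ hl0 h le_rfl h'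
      rw [inner_sub_left] at this
      linarith
    -- When `φ` is more than a half-turn ahead of `θ`, the comparison goes the other way round the
    -- closed curve, through its common endpoint.
    · have h1 := inner_scaledCurve_backward (K := K) (φ := φ) hτ hl0 le_rfl hφ2 (by linarith)
      have h2 := inner_scaledCurve_backward (K := K) (φ := φ - 2 * Real.pi) hτ hl0 (by linarith)
        hθ1 (by linarith)
      rw [unitVec_sub_two_pi] at h2
      rw [inner_sub_left] at h1 h2
      rw [hx] at h1
      linarith
  · rcases le_total θ (φ + Real.pi) with h' | h'
    · have := inner_scaledCurve_backward (K := K) hτ hl0 le_rfl h h'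
      rw [inner_sub_left] at this
      linarith
    · have h1 := inner_scaledCurve_forward (K := K) (φ := φ) hτ hl0 hφ1 le_rfl (by linarith)
      have h2 := inner_scaledCurve_forward (K := K) (φ := φ + 2 * Real.pi) hτ hl0 hθ2
        (by linarith) (by linarith)
      rw [unitVec_add_two_pi] at h2
      rw [inner_sub_left] at h1 h2
      rw [hx] at h2
      linarith

/-- A bounded family of points that satisfies the support inequalities spans a convex body. -/
lemma exists_body_of_support_inequality {T : Set ℝ} (hT : T.Nonempty) {f : ℝ → Euc 2} {C : ℝ}
    (hC : ∀ θ ∈ T, ‖f θ‖ ≤ C)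
    (hf : ∀ θ ∈ T, ∀ φ ∈ T, inner ℝ (f θ) (unitVec φ) ≤ inner ℝ (f φ) (unitVec φ)) :
    ∃ L : ConvexBody (Euc 2), ∀ φ ∈ T, supportFun L (unitVec φ) = inner ℝ (f φ) (unitVec φ) := by
  have hbdd : Bornology.IsBounded (f '' T) :=
    (Metric.isBounded_closedBall (x := (0 : Euc 2)) (r := C)).subset <| by
      rintro _ ⟨θ, hθ, rfl⟩
      exact mem_closedBall_zero_iff.2 (hC θ hθ)
  have hsub : f '' T ⊆ closure (convexHull ℝ (f '' T)) :=
    (subset_convexHull ℝ _).trans subset_closure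
  let L : ConvexBody (Euc 2) :=
    { carrier := closure (convexHull ℝ (f '' T))
      convex' := (convex_convexHull ℝ _).closure
      isCompact' := (isBounded_convexHull.2 hbdd).isCompact_closure
      nonempty' := (hT.image f).mono hsub }
  refine ⟨L, fun φ hφ => supportFun_eq_of_mem (hsub ⟨φ, hφ, rfl⟩) ?_⟩
  have hclosed : IsClosed {y : Euc 2 | inner ℝ y (unitVec φ) ≤ inner ℝ (f φ) (unitVec φ)} :=
    isClosed_le (by fun_prop) continuous_const
  have hconv : Convex ℝ {y : Euc 2 | inner ℝ y (unitVec φ) ≤ inner ℝ (f φ) (unitVec φ)} := by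
    intro x hx y hy a b ha hb hab
    simp only [mem_ofPred_eq] at hx hy ⊢
    rw [inner_add_left, real_inner_smul_left, real_inner_smul_left]
    calc _ ≤ a * inner ℝ (f φ) (unitVec φ) + b * inner ℝ (f φ) (unitVec φ) := by gcongr
      _ = _ := by rw [← add_mul, hab, one_mul]
  refine closure_minimal (convexHull_min ?_ hconv) hclosed
  rintro _ ⟨θ, hθ, rfl⟩
  exact hf θ hθ φ hφ

lemma norm_scaledCurve_le {R : ℝ} (hR : ∀ x ∈ K, ‖x‖ ≤ R) (θ : ℝ) :
    ‖scaledCurve K τ l θ‖ ≤ ∑ i, |l i| * R := by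
  refine (norm_sum_le _ _).trans (Finset.sum_le_sum fun i _ => ?_)
  rw [norm_smul, Real.norm_eq_abs]
  exact mul_le_mul_of_nonneg_left (hR _ (supportPoint_mem K _)) (abs_nonneg _)

/-- The constant by which the scaled boundary curve differs from a multiple of the original one on
the arc `j`. -/
noncomputable def arcOffset (K : ConvexBody (Euc 2)) (τ : Fin 5 → ℝ) (l : Fin 4 → ℝ) (j : Fin 4) :
    Euc 2 :=
  ∑ i ∈ Finset.univ.erase j,
    l i • supportPoint K (clamp (τ i.castSucc) (τ i.succ) (τ j.castSucc))

lemma scaledCurve_eq (hτ : Monotone τ) (j : Fin 4) {θ : ℝ}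
    (hθ : θ ∈ Icc (τ j.castSucc) (τ j.succ)) :
    scaledCurve K τ l θ = l j • supportPoint K θ + arcOffset K τ l j := by
  unfold scaledCurve arcOffset
  rw [← Finset.add_sum_erase _ _ (Finset.mem_univ j), clamp_of_mem hθ.1 hθ.2]
  congr 1
  refine Finset.sum_congr rfl fun i hi => ?_
  congr 2
  rcases lt_or_gt_of_ne (Finset.ne_of_mem_erase hi) with h | h
  · have h1 : τ i.succ ≤ τ j.castSucc := hτ (Fin.succ_le_castSucc_iff.2 h)
    rw [clamp_of_ge (arc_le hτ i) h1, clamp_of_ge (arc_le hτ i) (h1.trans hθ.1)]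
  · have h1 : τ j.succ ≤ τ i.castSucc := hτ (Fin.succ_le_castSucc_iff.2 h)
    rw [clamp_of_le (hθ.2.trans h1), clamp_of_le ((arc_le hτ j).trans h1)]

/-- With unit factors, consecutive arcs share an endpoint, so their offsets agree: the curve is a
translate of the original boundary. -/
lemma arcOffset_one (hτ : Monotone τ) (j : Fin 4) :
    arcOffset K τ (fun _ => 1) j = arcOffset K τ (fun _ => 1) 0 := by
  have hstep : ∀ i j : Fin 4, i.succ = j.castSucc →
      arcOffset K τ (fun _ => 1) j = arcOffset K τ (fun _ => 1) i := by
    intro i j hij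
    have h1 := scaledCurve_eq (K := K) (l := fun _ => 1) hτ i (θ := τ i.succ)
      ⟨arc_le hτ i, le_rfl⟩
    have h2 := scaledCurve_eq (K := K) (l := fun _ => 1) hτ j (θ := τ i.succ)
      ⟨by rw [hij], by rw [hij]; exact arc_le hτ j⟩
    exact add_left_cancel (h2.symm.trans h1)
  have h1 := hstep 0 1 rfl
  have h2 := hstep 1 2 rfl
  have h3 := hstep 2 3 rfl
  fin_cases j
  · rfl
  · exact h1
  · exact h2.trans h1
  · exact h3.trans (h2.trans h1)

lemma exists_arc (θ : ℝ) (hθ : θ ∈ Icc (τ 0) (τ (Fin.last 4))) :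
    ∃ j : Fin 4, θ ∈ Icc (τ j.castSucc) (τ j.succ) := by
  by_contra! h
  have hge : ∀ i : Fin 5, τ i ≤ θ := by
    intro i
    induction i using Fin.induction with
    | zero => exact hθ.1
    | succ j ih =>
      by_contra! hlt
      exact h j ⟨ih, hlt.le⟩
  exact h (Fin.last 3) ⟨hge _, hθ.2⟩

end Arcs

/-- Four vectors of the plane with sum zero admit a non-proportional linear relation with
coefficients between `0` and `1`. -/
lemma exists_nonconstant_relation {v : Fin 4 → Euc 2} (hv : ∑ i, v i = 0) :
    ∃ l : Fin 4 → ℝ, (∀ i, 0 ≤ l i) ∧ (∀ i, l i ≤ 1) ∧ ∑ i, l i • v i = 0 ∧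
      ¬ ∃ c, ∀ i, l i = c := by
  -- Three linear conditions on four unknowns; the condition `g 0 = 0` excludes the constant
  -- relation.
  let A : (Fin 4 → ℝ) →ₗ[ℝ] Euc 2 × ℝ :=
    (Fintype.linearCombination ℝ v).prod (LinearMap.proj 0)
  have hker : LinearMap.ker A ≠ ⊥ := by
    refine LinearMap.ker_ne_bot_of_finrank_lt ?_
    simp
  obtain ⟨g, hg, hg0⟩ := Submodule.exists_mem_ne_zero_of_ne_bot hker
  have hgA : A g = 0 := hg
  have h1 : ∑ i, g i • v i = 0 := congrArg Prod.fst hgA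
  have h2 : g 0 = 0 := congrArg Prod.snd hgA
  set S := ∑ i, |g i|
  obtain ⟨k, hk⟩ : ∃ k, g k ≠ 0 := Function.ne_iff.1 hg0
  have hle : ∀ i, |g i| ≤ S := fun i =>
    Finset.single_le_sum (f := fun i => |g i|) (fun _ _ => abs_nonneg _) (Finset.mem_univ i)
  have hS : 0 < S := (abs_pos.2 hk).trans_le (hle k)
  have hdiv : ∀ i, |g i / S| ≤ 1 := fun i => by
    rw [abs_div, abs_of_pos hS, div_le_one hS]
    exact hle i
  -- A perturbation of the constant relation `1 / 2`, small enough to stay in `[0, 1]`; its value at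
  -- `0` is `1 / 2`, at `k` it is not.
  refine ⟨fun i => (1 + g i / S) / 2, fun i => ?_, fun i => ?_, ?_, ?_⟩
  · linarith [(abs_le.1 (hdiv i)).1]
  · linarith [(abs_le.1 (hdiv i)).2]
  · have : ∀ i, ((1 + g i / S) / 2) • v i = (1 / 2 : ℝ) • v i + (1 / (2 * S)) • (g i • v i) := by
      intro i
      rw [smul_smul, ← add_smul]
      congr 1
      field_simp
    simp only [this]
    rw [Finset.sum_add_distrib, ← Finset.smul_sum, ← Finset.smul_sum, hv, h1, smul_zero, smul_zero,
      add_zero]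
  · rintro ⟨c, hc⟩
    have h3 := (hc k).trans (hc 0).symm
    simp only [h2, zero_div] at h3
    have h4 : g k / S = 0 := by linarith
    exact hk ((div_eq_zero_iff.1 h4).resolve_right hS.ne')

/-- A planar convex body whose support function is nonlinear on each of four consecutive arcs that
fill up the circle is the sum of two non-homothetic convex bodies. -/
theorem exists_add_eq_not_homothetic (K : ConvexBody (Euc 2)) {τ : Fin 5 → ℝ} (hτ : Monotone τ)
    (hper : τ (Fin.last 4) = τ 0 + 2 * Real.pi)
    (hnl : ∀ i : Fin 4, ¬ ∃ y : Euc 2, ∀ θ ∈ Icc (τ i.castSucc) (τ i.succ),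
      supportFun K (unitVec θ) = inner ℝ y (unitVec θ)) :
    ∃ L₁ L₂ : ConvexBody (Euc 2), L₁ + L₂ = K ∧ ¬ Homothetic L₁ L₂ := by
  have hsum : ∑ i : Fin 4, (supportPoint K (τ i.succ) - supportPoint K (τ i.castSucc)) = 0 := by
    have h1 : supportPoint K (τ (Fin.last 4)) = supportPoint K (τ 0) := by
      rw [hper, supportPoint_add_two_pi]
    rw [Finset.sum_sub_distrib, sub_eq_zero]
    have h2 := Fin.sum_univ_succ (fun i => supportPoint K (τ i))
    rw [Fin.sum_univ_castSucc, h1, add_comm] at h2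
    exact (add_left_cancel h2).symm
  obtain ⟨l, hl0, hl1, hl, hlc⟩ := exists_nonconstant_relation hsum
  have hl' : ∑ i : Fin 4, (1 - l i) • (supportPoint K (τ i.succ) - supportPoint K (τ i.castSucc))
      = 0 := by
    simp only [sub_smul _ _ (_ : Euc 2), one_smul]
    rw [Finset.sum_sub_distrib, hsum, hl, sub_zero]
  have hl0' : ∀ i, 0 ≤ 1 - l i := fun i => sub_nonneg.2 (hl1 i)
  obtain ⟨R, -, hR⟩ := exists_norm_le K
  have hT : (Icc (τ 0) (τ (Fin.last 4))).Nonempty := nonempty_Icc.2 (hτ (Fin.zero_le _))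
  obtain ⟨L₁, h₁⟩ := exists_body_of_support_inequality hT
    (fun θ _ => norm_scaledCurve_le (τ := τ) (l := l) hR θ)
    (fun θ hθ φ hφ => inner_scaledCurve_le hτ hper hl0 hl hθ hφ)
  obtain ⟨L₂, h₂⟩ := exists_body_of_support_inequality hT
    (fun θ _ => norm_scaledCurve_le (τ := τ) (l := fun i => 1 - l i) hR θ)
    (fun θ hθ φ hφ => inner_scaledCurve_le hτ hper hl0' hl' hθ hφ)
  set q := arcOffset K τ (fun _ => 1) 0 with hq
  have harc : ∀ j : Fin 4, ∀ θ ∈ Icc (τ j.castSucc) (τ j.succ), θ ∈ Icc (τ 0) (τ (Fin.last 4)) :=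
    fun j θ hθ => ⟨(hτ (Fin.zero_le _)).trans hθ.1, hθ.2.trans (hτ (Fin.le_last _))⟩
  have e₁ : ∀ j : Fin 4, ∀ θ ∈ Icc (τ j.castSucc) (τ j.succ), supportFun L₁ (unitVec θ)
      = l j * supportFun K (unitVec θ) + inner ℝ (arcOffset K τ l j) (unitVec θ) := by
    intro j θ hθ
    rw [h₁ θ (harc j θ hθ), scaledCurve_eq hτ j hθ, inner_add_left, real_inner_smul_left,
      inner_supportPoint]
  have e₂ : ∀ j : Fin 4, ∀ θ ∈ Icc (τ j.castSucc) (τ j.succ), supportFun L₂ (unitVec θ)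
      = (1 - l j) * supportFun K (unitVec θ)
        + inner ℝ (arcOffset K τ (fun i => 1 - l i) j) (unitVec θ) := by
    intro j θ hθ
    rw [h₂ θ (harc j θ hθ), scaledCurve_eq hτ j hθ, inner_add_left, real_inner_smul_left,
      inner_supportPoint]
  have hoff : ∀ j, arcOffset K τ l j + arcOffset K τ (fun i => 1 - l i) j = q := by
    intro j
    rw [hq, ← arcOffset_one hτ j]
    unfold arcOffset
    rw [← Finset.sum_add_distrib]
    refine Finset.sum_congr rfl fun i _ => ?_
    rw [← add_smul]
    congr 1
    ring
  -- If `L` is a homothetic copy of `L'` with ratio `c`, then on arc `j` the multiple `a j * (1 + c)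
  -- - c` of the support function of `K` is linear, so it vanishes. All factors are then equal,
  -- contrary to the choice of `l`.
  have hnot : ∀ (L L' : ConvexBody (Euc 2)) (a : Fin 4 → ℝ) (o o' : Fin 4 → Euc 2),
      (∀ j : Fin 4, ∀ θ ∈ Icc (τ j.castSucc) (τ j.succ), supportFun L (unitVec θ)
        = a j * supportFun K (unitVec θ) + inner ℝ (o j) (unitVec θ)) →
      (∀ j : Fin 4, ∀ θ ∈ Icc (τ j.castSucc) (τ j.succ), supportFun L' (unitVec θ)
        = (1 - a j) * supportFun K (unitVec θ) + inner ℝ (o' j) (unitVec θ)) →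
      ∀ (c : ℝ) (x : Euc 2), 0 ≤ c →
        (L : Set (Euc 2)) = (fun y => c • y + x) '' (L' : Set (Euc 2)) →
        ∀ j, a j = c / (1 + c) := by
    intro L L' a o o' hL hL' c x hc h j
    by_contra hne
    have hc1 : a j * (1 + c) - c ≠ 0 := fun h0 => hne (by
      rw [eq_div_iff (by positivity)]; linarith)
    refine hnl j ⟨(a j * (1 + c) - c)⁻¹ • (c • o' j + x - o j), fun θ hθ => ?_⟩
    have h3 := supportFun_of_homothety hc x h (unitVec θ)
    rw [hL j θ hθ, hL' j θ hθ] at h3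
    rw [real_inner_smul_left, eq_inv_mul_iff_mul_eq₀ hc1, inner_sub_left, inner_add_left,
      real_inner_smul_left]
    linarith
  have hhom : ¬ Homothetic L₁ L₂ := by
    rintro ⟨c, x, hc, h | h⟩
    · exact hlc ⟨_, hnot L₁ L₂ l _ _ e₁ e₂ c x hc h⟩
    · refine hlc ⟨1 - c / (1 + c), fun j => ?_⟩
      have := hnot L₂ L₁ (fun i => 1 - l i) _ _ e₂
        (fun j θ hθ => by rw [sub_sub_cancel]; exact e₁ j θ hθ) c x hc h j
      linarith
  -- The two scaled curves add up to the boundary of `K` shifted by `q`, which the translation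
  -- removes.
  refine ⟨L₁, translate L₂ (-q), ?_, fun h => hhom ?_⟩
  · refine eq_of_supportFun_eq fun ν hν => ?_
    obtain ⟨θ, hθ, rfl⟩ := exists_eq_unitVec (τ 0) hν
    obtain ⟨j, hj⟩ := exists_arc (τ := τ) θ ⟨hθ.1, by rw [hper]; exact hθ.2.le⟩
    rw [supportFun_add, supportFun_translate, e₁ j θ hj, e₂ j θ hj, inner_neg_left, ← hoff j,
      inner_add_left]
    ring
  · obtain ⟨c, x, hc, h | h⟩ := h
    · refine ⟨c, x - c • q, hc, Or.inl ?_⟩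
      rw [h]
      change _ '' ((fun y => y + -q) '' (L₂ : Set (Euc 2))) = _
      rw [image_image]
      refine image_congr fun y _ => ?_
      rw [smul_add, smul_neg]; abel
    · refine ⟨c, x + q, hc, Or.inr ?_⟩
      have h' : (fun y => y + -q) '' (L₂ : Set (Euc 2)) = (fun y => c • y + x) '' (L₁ : Set (Euc 2)) :=
        h
      have h2 : (L₂ : Set (Euc 2)) = (fun y => y + q) '' ((fun y => y + -q) '' (L₂ : Set (Euc 2))) := by
        rw [image_image]
        simp
      rw [h2, h', image_image]
      refine image_congr fun y _ => ?_
      rw [add_assoc]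

/-! ### Exposed points and the shape of planar minimizers. -/

/-- `z` is the only point of `K` in which the linear functional `⟪·, ν⟫` attains its maximum. -/
def IsExposedBy {n : ℕ} (K : ConvexBody (Euc n)) (ν z : Euc n) : Prop :=
  z ∈ K ∧ ∀ y ∈ K, y ≠ z → inner ℝ y ν < inner ℝ z ν

/-- The points of `K` that are exposed by some unit vector. -/
def exposedSet {n : ℕ} (K : ConvexBody (Euc n)) : Set (Euc n) :=
  {z | ∃ ν : Euc n, ‖ν‖ = 1 ∧ IsExposedBy K ν z}

lemma IsExposedBy.unique {n : ℕ} {K : ConvexBody (Euc n)} {ν z y : Euc n}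
    (h : IsExposedBy K ν z) (hy : y ∈ K) (hyν : supportFun K ν = inner ℝ y ν) : y = z := by
  by_contra hne
  have h1 := h.2 y hy hne
  have h2 := inner_le_supportFun h.1 ν
  linarith

/-- A point of a convex body farthest from a given point is exposed. -/
lemma mem_exposedSet_of_farthest {n : ℕ} (hn : 1 ≤ n) {K : ConvexBody (Euc n)} {a z : Euc n}
    (hz : z ∈ K) (h : ∀ y ∈ K, ‖y - a‖ ≤ ‖z - a‖) : z ∈ exposedSet K := by
  rcases eq_or_ne (z - a) 0 with h0 | h0
  · have : Nontrivial (Euc n) := by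
      refine Module.nontrivial_of_finrank_pos (R := ℝ) ?_
      rw [finrank_euclideanSpace_fin]; omega
    obtain ⟨v, hv⟩ := exists_norm_eq (Euc n) zero_le_one
    refine ⟨v, hv, hz, fun y hy hne => absurd ?_ hne⟩
    have h1 := h y hy
    rw [h0, norm_zero, norm_le_zero_iff] at h1
    exact sub_left_injective (h1.trans h0.symm)
  · have hpos : 0 < ‖z - a‖ := norm_pos_iff.2 h0
    refine ⟨‖z - a‖⁻¹ • (z - a), by rw [norm_smul, norm_inv, norm_norm, inv_mul_cancel₀ hpos.ne'],
      hz, fun y hy hne => ?_⟩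
    rw [real_inner_smul_right, real_inner_smul_right]
    refine mul_lt_mul_of_pos_left ?_ (inv_pos.2 hpos)
    have h1 := h y hy
    have h2 : 0 < ‖(y - a) - (z - a)‖ := by
      rw [sub_sub_sub_cancel_right]
      exact norm_pos_iff.2 (sub_ne_zero.2 hne)
    have h3 := norm_sub_sq_real (y - a) (z - a)
    have h4 : inner ℝ (y - a) (z - a) < inner ℝ (z - a) (z - a) := by
      rw [real_inner_self_eq_norm_sq]
      nlinarith [norm_nonneg (y - a)]
    rw [inner_sub_left, inner_sub_left z] at h4
    linarith

/-- A closed convex set that contains the exposed points of a convex body contains the body. -/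
lemma subset_of_exposedSet_subset {n : ℕ} (hn : 1 ≤ n) {K : ConvexBody (Euc n)} {C : Set (Euc n)}
    (hC : Convex ℝ C) (hC' : IsClosed C) (h : exposedSet K ⊆ C) : (K : Set (Euc n)) ⊆ C := by
  intro x₀ hx₀
  by_contra hx
  obtain ⟨f, u, hf, hu⟩ := geometric_hahn_banach_closed_point hC hC' hx
  set w : Euc n := (InnerProductSpace.toDual ℝ (Euc n)).symm f
  have hw : ∀ y, f y = inner ℝ y w := by
    intro y
    rw [real_inner_comm]
    exact (InnerProductSpace.toDual_symm_apply).symm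
  obtain ⟨B, hB0, hB⟩ := exists_norm_le K
  have hgap : 0 < f x₀ - u := sub_pos.2 hu
  -- From the remote centre `-(R • w)` a farthest point of `K` nearly maximizes `f`. With this `R`,
  -- a farthest point `z` with `f z < u` would be closer than `x₀`, because `‖z‖ ^ 2 ≤ B ^ 2`.
  set R := (B ^ 2 + 1) / (2 * (f x₀ - u)) with hR
  have hR0 : 0 < R := by positivity
  obtain ⟨z, hz, hmax⟩ := K.isCompact.exists_isMaxOn K.nonempty
    (f := fun y : Euc n => ‖y - (-(R • w))‖) (by fun_prop)
  have hzC := hf z (h (mem_exposedSet_of_farthest hn hz fun y hy => hmax hy))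
  have h1 : ‖x₀ - (-(R • w))‖ ≤ ‖z - (-(R • w))‖ := hmax hx₀
  have h2 := pow_le_pow_left₀ (norm_nonneg _) h1 2
  rw [sub_neg_eq_add, sub_neg_eq_add, norm_add_sq_real, norm_add_sq_real, real_inner_smul_right,
    real_inner_smul_right, ← hw, ← hw] at h2
  have h3 := pow_le_pow_left₀ (norm_nonneg _) (hB z hz) 2
  have h4 : R * (2 * (f x₀ - u)) = B ^ 2 + 1 := by
    rw [hR]; field_simp
  nlinarith [sq_nonneg ‖x₀‖, mul_lt_mul_of_pos_left hzC hR0]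

lemma unitVec_add_unitVec (s t : ℝ) :
    unitVec s + unitVec t = (2 * Real.cos ((s - t) / 2)) • unitVec ((s + t) / 2) := by
  ext i
  fin_cases i
  · simp only [unitVec, Fin.zero_eta, PiLp.add_apply, PiLp.smul_apply,
      Matrix.cons_val_zero, smul_eq_mul]
    rw [Real.cos_add_cos]; ring
  · simp only [unitVec, Fin.mk_one, PiLp.add_apply, PiLp.smul_apply,
      Matrix.cons_val_one, Matrix.cons_val_fin_one, smul_eq_mul]
    have h1 : s = (s + t) / 2 + (s - t) / 2 := by ring
    have h2 : t = (s + t) / 2 - (s - t) / 2 := by ring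
    conv_lhs => rw [h1, Real.sin_add]
    conv_lhs => enter [2]; rw [h2, Real.sin_sub]
    ring

/-- On an arc whose end points expose different points, the support function is not linear. -/
lemma not_linear_of_exposed {K : ConvexBody (Euc 2)} {s t : ℝ} (hst : s ≤ t) {z z' : Euc 2}
    (hz : IsExposedBy K (unitVec s) z) (hz' : IsExposedBy K (unitVec t) z') (hne : z ≠ z') :
    ¬ ∃ y : Euc 2, ∀ θ ∈ Icc s t, supportFun K (unitVec θ) = inner ℝ y (unitVec θ) := by
  rintro ⟨y, hy⟩
  -- The sum of the end directions is a multiple of the middle one. If the support function is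
  -- linear, a point extremal in the middle is extremal at both ends, hence equal to both `z` and
  -- `z'`.
  obtain ⟨p, hp, hpr⟩ := exists_supportFun_eq K (unitVec ((s + t) / 2))
  have h1 := hy s ⟨le_rfl, hst⟩
  have h2 := hy t ⟨hst, le_rfl⟩
  have h3 := hy ((s + t) / 2) ⟨by linarith, by linarith⟩
  have h4 : supportFun K (unitVec s) + supportFun K (unitVec t)
      = inner ℝ p (unitVec s) + inner ℝ p (unitVec t) := by
    rw [h1, h2, ← inner_add_right, ← inner_add_right, unitVec_add_unitVec, real_inner_smul_right,
      real_inner_smul_right, ← h3, hpr]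
  have h5 := inner_le_supportFun hp (unitVec s)
  have h6 := inner_le_supportFun hp (unitVec t)
  exact hne ((hz.unique hp (by linarith)).symm.trans (hz'.unique hp (by linarith)))

/-- A planar convex body with at least four exposed points is the sum of two non-homothetic convex
bodies. -/
lemma exists_add_eq_of_four_exposed {K : ConvexBody (Euc 2)} (h : 4 ≤ (exposedSet K).encard) :
    ∃ L₁ L₂ : ConvexBody (Euc 2), L₁ + L₂ = K ∧ ¬ Homothetic L₁ L₂ := by
  classical
  obtain ⟨t, ht, htc⟩ := exists_subset_encard_eq h
  have htf : t.Finite := finite_of_encard_eq_coe (k := 4) (by exact_mod_cast htc)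
  have hang : ∀ z ∈ t, ∃ θ ∈ Ico (0 : ℝ) (0 + 2 * Real.pi), IsExposedBy K (unitVec θ) z := by
    intro z hz
    obtain ⟨ν, hν, hexp⟩ := ht hz
    obtain ⟨θ, hθ, rfl⟩ := exists_eq_unitVec 0 hν
    exact ⟨θ, hθ, hexp⟩
  choose! ang hang1 hang2 using hang
  have huniq : ∀ {ν z z' : Euc 2}, IsExposedBy K ν z → IsExposedBy K ν z' → z = z' := by
    intro ν z z' hz hz'
    refine hz'.unique hz.1 (supportFun_eq_of_mem hz.1 fun y hy => ?_)
    rcases eq_or_ne y z with rfl | hne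
    · exact le_rfl
    · exact (hz.2 y hy hne).le
  have hinj : InjOn ang t := fun z hz z' hz' heq =>
    huniq (hang2 z hz) (heq ▸ hang2 z' hz')
  set S := htf.toFinset.image ang
  have hScard : S.card = 4 := by
    rw [Finset.card_image_of_injOn (by simpa using hinj)]
    rw [htf.encard_eq_coe_toFinset_card] at htc
    exact_mod_cast htc
  set a := S.orderEmbOfFin hScard
  have ha : ∀ i, ∃ z ∈ t, ang z = a i := by
    intro i
    obtain ⟨z, hz, hz'⟩ := Finset.mem_image.1 (S.orderEmbOfFin_mem hScard i)
    exact ⟨z, htf.mem_toFinset.1 hz, hz'⟩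
  choose z hzt hza using ha
  have hexp : ∀ i, IsExposedBy K (unitVec (a i)) (z i) := fun i => hza i ▸ hang2 _ (hzt i)
  have hIco : ∀ i, a i ∈ Ico (0 : ℝ) (0 + 2 * Real.pi) := fun i => hza i ▸ hang1 _ (hzt i)
  have hzne : ∀ {i j}, i ≠ j → z i ≠ z j := fun hij heq =>
    hij (a.injective (by rw [← hza, ← hza, heq]))
  -- The four exposing angles in increasing order, closed up by the first one after a full turn.
  set τ : Fin 5 → ℝ := Fin.snoc (α := fun _ => ℝ) a (a 0 + 2 * Real.pi)
  have hcast : ∀ i : Fin 4, τ i.castSucc = a i := fun i => Fin.snoc_castSucc (α := fun _ => ℝ) _ _ i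
  have hlast : τ (Fin.last 4) = a 0 + 2 * Real.pi := Fin.snoc_last (α := fun _ => ℝ) _ _
  have hmono : Monotone τ := by
    refine Fin.monotone_iff_le_succ.2 fun i => ?_
    induction i using Fin.lastCases with
    | last =>
      rw [Fin.succ_last, hcast, hlast]
      linarith [(hIco (Fin.last 3)).2, (hIco 0).1]
    | cast i =>
      rw [Fin.succ_castSucc, hcast, hcast]
      exact a.monotone (Fin.castSucc_lt_succ).le
  refine exists_add_eq_not_homothetic K hmono ?_ fun i => ?_
  · rw [hlast, show (0 : Fin 5) = Fin.castSucc 0 from rfl, hcast]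
  · induction i using Fin.lastCases with
    | last =>
      refine not_linear_of_exposed (z := z (Fin.last 3)) (z' := z 0) (hmono Fin.castSucc_lt_succ.le)
        ?_ ?_ (hzne (by decide))
      · rw [hcast]; exact hexp _
      · rw [Fin.succ_last, hlast, unitVec_add_two_pi]; exact hexp _
    | cast i =>
      refine not_linear_of_exposed (z := z i.castSucc) (z' := z i.succ)
        (hmono Fin.castSucc_lt_succ.le) ?_ ?_ (hzne Fin.castSucc_lt_succ.ne)
      · rw [hcast]; exact hexp _
      · rw [Fin.succ_castSucc, hcast]; exact hexp _

/-- In the direction exposing `b`, both `a` and `c` are strictly lower, and so is every point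
between them. Three exposed points thus cannot be collinear. -/
lemma not_wbtw_of_mem_exposedSet {n : ℕ} {K : ConvexBody (Euc n)} {a b c : Euc n}
    (ha : a ∈ exposedSet K) (hb : b ∈ exposedSet K) (hc : c ∈ exposedSet K) (hab : a ≠ b)
    (hcb : c ≠ b) : ¬ Wbtw ℝ a b c := by
  rintro ⟨r, hr, hr'⟩
  obtain ⟨ν, -, hb'⟩ := hb
  obtain ⟨_, -, ha'⟩ := ha
  obtain ⟨_, -, hc'⟩ := hc
  have h1 := hb'.2 a ha'.1 hab
  have h2 := hb'.2 c hc'.1 hcb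
  have h3 : inner ℝ b ν = (1 - r) * inner ℝ a ν + r * inner ℝ c ν := by
    rw [← hr', AffineMap.lineMap_apply_module, inner_add_left, real_inner_smul_left,
      real_inner_smul_left]
  rcases hr.1.eq_or_lt with h0 | h0
  · rw [← h0] at h3; linarith
  · nlinarith [hr.2, mul_lt_mul_of_pos_left h2 h0,
      mul_le_mul_of_nonneg_left h1.le (sub_nonneg.2 hr.2)]

/-- A convex body with more than one point and at most three exposed points is a triangle or a
segment. -/
lemma isTriangle_or_isSegment {n : ℕ} (hn : 1 ≤ n) {K : ConvexBody (Euc n)}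
    (hK : K ∈ nontrivialBodies n) (h : (exposedSet K).encard < 4) : IsTriangle K ∨ IsSegment K := by
  have hfin : (exposedSet K).Finite := finite_of_encard_le_coe (k := 4) (by exact_mod_cast h.le)
  have hcard : (exposedSet K).ncard < 4 := by
    rw [← hfin.cast_ncard_eq] at h
    exact_mod_cast h
  have hKX : (K : Set (Euc n)) = convexHull ℝ (exposedSet K) := by
    refine (subset_of_exposedSet_subset hn (convex_convexHull ℝ _)
      (hfin.isCompact_convexHull (𝕜 := ℝ)).isClosed (subset_convexHull ℝ _)).antisymm
      (convexHull_min ?_ K.convex)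
    rintro z ⟨ν, -, hz⟩
    exact hz.1
  have hcases : (exposedSet K).ncard = 0 ∨ (exposedSet K).ncard = 1 ∨ (exposedSet K).ncard = 2 ∨
      (exposedSet K).ncard = 3 := by omega
  rcases hcases with h0 | h1 | h2 | h3
  · rw [(ncard_eq_zero hfin).1 h0, convexHull_empty] at hKX
    exact absurd hKX K.nonempty.ne_empty
  · obtain ⟨a, ha⟩ := ncard_eq_one.1 h1
    rw [ha, convexHull_singleton] at hKX
    have : (K : Set (Euc n)).Nontrivial := hK
    rw [hKX] at this
    exact absurd this not_nontrivial_singleton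
  · obtain ⟨a, b, hab, he⟩ := ncard_eq_two.1 h2
    rw [he, convexHull_pair] at hKX
    exact Or.inr ⟨a, b, hab, hKX⟩
  · obtain ⟨a, b, c, hab, hac, hbc, he⟩ := ncard_eq_three.1 h3
    have ha : a ∈ exposedSet K := by rw [he]; simp
    have hb : b ∈ exposedSet K := by rw [he]; simp
    have hc : c ∈ exposedSet K := by rw [he]; simp
    refine Or.inl ⟨![a, b, c], ?_, ?_⟩
    · rw [affineIndependent_iff_not_collinear_set]
      intro hcol
      rcases hcol.wbtw_or_wbtw_or_wbtw with hw | hw | hw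
      · exact not_wbtw_of_mem_exposedSet ha hb hc hab hbc.symm hw
      · exact not_wbtw_of_mem_exposedSet hb hc ha hbc hac hw
      · exact not_wbtw_of_mem_exposedSet hc ha hb hac.symm hab.symm hw
    · rw [hKX, he]
      congr 1
      ext x
      simp only [Matrix.range_cons, Matrix.range_empty, union_empty, mem_insert_iff,
        mem_singleton_iff, mem_union]

/-- A minimizer in the plane is a triangle or a segment. -/
theorem IsConcaveShape.isTriangle_or_isSegment_of_isMinimizer {G : ConvexBody (Euc 2) → ℝ≥0∞}
    (hstrict : ∀ K L : ConvexBody (Euc 2), ¬ Homothetic K L → G K + G L < G (K + L))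
    {K : ConvexBody (Euc 2)} (hK : IsMinimizer 1 G K) : IsTriangle K ∨ IsSegment K := by
  refine isTriangle_or_isSegment one_le_two hK.1 ?_
  by_contra! h
  obtain ⟨L₁, L₂, hsum, hnot⟩ := exists_add_eq_of_four_exposed h
  exact hnot (homothetic_of_isMinimizer one_le_two hstrict (hsum ▸ hK))

end ConvexShape

/-! ### Reduction of the theorem to `G = F^{1/α}`. -/

theorem theorem2p1 (n : ℕ) (hn : 1 ≤ n) (α : ℝ) (hα : α ≠ 0)
    (F : ConvexBody (Euc n) → ℝ≥0∞)
    (hhom : ConvexShape.IsHomogeneous α F)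
    (hcont : Continuous F)
    (hinv : ConvexShape.IsRigidMotionInvariant F)
    (hBM : ConvexShape.SatisfiesBrunnMinkowski α F) :
    ((∃ B : ConvexBody (Euc n), ConvexShape.IsBall B ∧ ConvexShape.IsMaximizer α F B) ∧
      ∀ B : ConvexBody (Euc n), ConvexShape.IsBall B → ConvexShape.IsMaximizer α F B) ∧
    (ConvexShape.BrunnMinkowskiStrict α F →
      (∀ K : ConvexBody (Euc n), ConvexShape.IsMaximizer α F K → ConvexShape.IsBall K) ∧
      (n = 2 → ∀ K : ConvexBody (Euc n), ConvexShape.IsMinimizer α F K →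
        ConvexShape.IsTriangle K ∨ ConvexShape.IsSegment K)) := by
  set G : ConvexBody (Euc n) → ℝ≥0∞ := fun K => F K ^ (1 / α) with hGdef
  have hG : ConvexShape.IsConcaveShape G :=
    { smul := fun K t ht => by
        simp only [hGdef]
        have h0 : ENNReal.ofReal t ≠ 0 := (ENNReal.ofReal_pos.2 ht).ne'
        have h1 : ENNReal.ofReal t ^ α ≠ 0 := by
          simp [ENNReal.rpow_eq_zero_iff, h0]
        have h2 : ENNReal.ofReal t ^ α ≠ ∞ := ENNReal.rpow_ne_top_of_ne_zero h0 ENNReal.ofReal_ne_top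
        -- For a negative exponent the power of a product splits except for `0 * ∞`, which cannot
        -- occur because `t ^ α` is neither zero nor infinite.
        rw [hhom K t ht, ENNReal.mul_rpow_eq_ite, if_neg (by simp [h1, h2]), ← ENNReal.rpow_mul,
          mul_one_div_cancel hα, ENNReal.rpow_one]
      rigid := fun f x K L hf h => by
        simp only [hGdef]
        rw [hinv f x K L hf h]
      add_le := hBM }
  have hGcont : Continuous G := (ENNReal.continuous_rpow_const (y := 1 / α)).comp hcont
  have hquot : ∀ K, ConvexShape.shapeQuotient α F K = ConvexShape.shapeQuotient 1 G K := by
    intro K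
    rw [ConvexShape.shapeQuotient_one]
    rfl
  have hmaxiff : ∀ K, ConvexShape.IsMaximizer α F K ↔ ConvexShape.IsMaximizer 1 G K := by
    intro K
    simp only [ConvexShape.IsMaximizer, hquot]
  have hminiff : ∀ K, ConvexShape.IsMinimizer α F K ↔ ConvexShape.IsMinimizer 1 G K := by
    intro K
    simp only [ConvexShape.IsMinimizer, hquot]
  have hball : ∀ B : ConvexBody (Euc n), ConvexShape.IsBall B → ConvexShape.IsMaximizer α F B :=
    fun B hB => (hmaxiff B).2 (hG.isMaximizer_of_isBall hGcont hn hB)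
  refine ⟨⟨?_, hball⟩, fun hstrict => ⟨fun K hK => ?_, ?_⟩⟩
  · have hB : ConvexShape.IsBall (ConvexShape.ballBody (0 : Euc n) zero_le_one) :=
      ⟨0, 1, one_pos, rfl⟩
    exact ⟨_, hB, hball _ hB⟩
  · exact hG.isBall_of_isMaximizer hn hstrict ((hmaxiff K).1 hK)
  · rintro rfl K hK
    exact ConvexShape.IsConcaveShape.isTriangle_or_isSegment_of_isMinimizer hstrict
      ((hminiff K).1 hK)
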